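/- Fix $\Lambda>0$ and put $\Omega_L=(-\infty,-\Lambda)$, $\Omega_R=(\Lambda,\infty)$, $\Omega_\Lambda=\Omega_L\cup\Omega_R$. For $\Omega$ one of these sets let $AC^2(\overline\Omega)$ be the set of functions $\psi$ on $\overline\Omega$ that are differentiable (one-sidedly at the boundary points), such that $\psi$ and $\psi'$ are absolutely continuous on every compact interval contained in $\overline\Omega$ and $\psi''\in L^2(\Omega)$. Let $H_0$ be the closure in $L^2(\Omega_\Lambda)$ of $-d^2/dx^2$ with domain $C_0^\infty(\Omega_\Lambda)$; its adjoint $H_0^*$ is $-d^2/dx^2$ with domain $D(H_0^*)=L^2(\Omega_\Lambda)\cap AC^2(\overline{\Omega_\Lambda})$. With $N=\sqrt[4]{2}\,e^{\Lambda/\sqrt2}$ let $$L_\pm(x)=N e^{(1\mp i)x/\sqrt2}\ (x<-\Lambda),\quad L_\pm(x)=0\ (x>\Lambda),\qquad R_\pm(x)=0\ (x<-\Lambda),\quad R_\pm(x)=N e^{(-1\pm i)x/\sqrt2}\ (x>\Lambda).$$ (i) Let $\theta_L,\theta_R\in[0,2\pi)$, $\gamma_L=e^{i(\theta_L+\sqrt2\Lambda)}$,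 $\gamma_R=e^{i(\theta_R+\sqrt2\Lambda)}$, $\gamma=(\gamma_L,\gamma_R)$. The operator $H_\gamma=-d^2/dx^2$ with domain $$D(H_\gamma)=\{\psi_0+c_L(L_++\gamma_LL_-)+c_R(R_++\gamma_RR_-)\;:\;\psi_0\in D(H_0),\ c_L,c_R\in\mathbb C\}$$ is well defined (that is, $D(H_\gamma)\subset D(H_0^*)$) and is a self-adjoint extension of $H_0$. (ii) Let $\alpha=(\alpha_L,\alpha_R)\in(\mathbb R\cup\{\infty\})^2$. The operator $H_\alpha=-d^2/dx^2$, whose domain consists of all $\psi\in D(H_0^*)$ with $$\psi'(-\Lambda)=\alpha_L\psi(-\Lambda)\quad\text{and}\quad\psi'(\Lambda)=\alpha_R\psi(\Lambda),$$ where for $\alpha_L=\infty$ the first condition is read as $\psi(-\Lambda)=0$ and for $\alpha_R=\infty$ the second one as $\psi(\Lambda)=0$, is a self-adjoint extension of $H_0$. (The Neumann condition $\psi'=0$ is the case $\alpha_\sharp=0$.) (iii) For $\theta_L,\theta_R\in[0,2\pi)$, with $\gamma$ as in (i), and $\alpha\in(\mathbb R\cup\{\infty\})^2$, one has $H_\alpha=H_\gamma$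 if and only if $$\alpha_L=\frac{1+\cos\theta_L-\sin\theta_L}{\sqrt2(1+\cos\theta_L)}\quad\text{and}\quad \alpha_R=-\frac{1+\cos\theta_R-\sin\theta_R}{\sqrt2(1+\cos\theta_R)},$$ where the right-hand side is read as $\infty$ if the angle equals $\pi$. This correspondence is a bijection between the $(\theta_L,\theta_R)\in[0,2\pi)^2$ and the $\alpha\in(\mathbb R\cup\{\infty\})^2$. Moreover, for every $\alpha\in(\mathbb R\cup\{\infty\})^2$, $H_\alpha\cong H_{\alpha_L}\oplus H_{\alpha_R}$: the unitary map $\psi\mapsto(\psi|_{\Omega_L},\psi|_{\Omega_R})$ from $L^2(\Omega_\Lambda)$ onto $L^2(\Omega_L)\oplus L^2(\Omega_R)$ carries $H_\alpha$ to $H_{\alpha_L}\oplus H_{\alpha_R}$. Here $H_{\alpha_L}$ is $-d^2/dx^2$ in $L^2(\Omega_L)$ on the $\psi\in L^2(\Omega_L)\cap AC^2(\overline{\Omega_L})$ satisfying the boundary condition at $-\Lambda$ with parameter $\alpha_L$, and $H_{\alpha_R}$ is $-d^2/dx^2$ in $L^2(\Omega_R)$ on the $\psi\in L^2(\Omega_R)\cap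 AC^2(\overline{\Omega_R})$ satisfying the boundary condition at $\Lambda$ with parameter $\alpha_R$. -/

import Mathlib

open MeasureTheory Set
open scoped ContDiff LinearPMap

noncomputable section

namespace Junction

/-- The Hilbert space `L²(Ω)` of an open subset `Ω` of the line. -/
abbrev L2 (Ω : TopologicalSpace.Opens ℝ) : Type :=
  Lp ℂ 2 (volume.restrict (Ω : Set ℝ))

/-- The island `Ω_L = (-∞, -Λ)`. -/
def leftIsland (Λ : ℝ) : TopologicalSpace.Opens ℝ := ⟨Iio (-Λ), isOpen_Iio⟩

/-- The island `Ω_R = (Λ, ∞)`. -/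
def rightIsland (Λ : ℝ) : TopologicalSpace.Opens ℝ := ⟨Ioi Λ, isOpen_Ioi⟩

/-- The line with the junction `[-Λ, Λ]` removed, `Ω_Λ = (-∞, -Λ) ∪ (Λ, ∞)`. -/
def islands (Λ : ℝ) : TopologicalSpace.Opens ℝ :=
  ⟨Iio (-Λ) ∪ Ioi Λ, isOpen_Iio.union isOpen_Ioi⟩

/-! ### The class `AC²` and the operator `-d²/dx²` on it -/

/-- The first derivative on the closure of `Ω`; it is one-sided at the boundary points of `Ω`. -/
def d1 (Ω : TopologicalSpace.Opens ℝ) (ψ : ℝ → ℂ) : ℝ → ℂ :=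
  derivWithin ψ (closure (Ω : Set ℝ))

/-- The second derivative on the closure of `Ω`. -/
def d2 (Ω : TopologicalSpace.Opens ℝ) (ψ : ℝ → ℂ) : ℝ → ℂ :=
  d1 Ω (d1 Ω ψ)

/-- `ψ` is of class `AC²` on the closure of `Ω`: it is differentiable there, `ψ` and its
derivative are absolutely continuous on every compact interval contained in the closure,
and the second derivative is square integrable on `Ω`. The values of `ψ` off the closure of
`Ω` are irrelevant. -/
structure IsAC2 (Ω : TopologicalSpace.Opens ℝ) (ψ : ℝ → ℂ) : Prop where
  ac : ∀ a b : ℝ, uIcc a b ⊆ closure (Ω : Set ℝ) → AbsolutelyContinuousOnInterval ψ a b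
  diff : DifferentiableOn ℝ ψ (closure (Ω : Set ℝ))
  ac_d1 : ∀ a b : ℝ, uIcc a b ⊆ closure (Ω : Set ℝ) →
    AbsolutelyContinuousOnInterval (d1 Ω ψ) a b
  memLp_d2 : MemLp (d2 Ω ψ) 2 (volume.restrict (Ω : Set ℝ))

variable {Ω : TopologicalSpace.Opens ℝ}

lemma d1_congr {ψ φ : ℝ → ℂ} (h : EqOn ψ φ (Ω : Set ℝ)) :
    EqOn (d1 Ω ψ) (d1 Ω φ) (Ω : Set ℝ) := by
  intro x hx
  have hn : closure (Ω : Set ℝ) ∈ nhds x :=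
    Filter.mem_of_superset (Ω.isOpen.mem_nhds hx) subset_closure
  simp only [d1, derivWithin_of_mem_nhds hn]
  exact Filter.EventuallyEq.deriv_eq (Filter.mem_of_superset (Ω.isOpen.mem_nhds hx) h)

lemma d2_congr {ψ φ : ℝ → ℂ} (h : EqOn ψ φ (Ω : Set ℝ)) :
    EqOn (d2 Ω ψ) (d2 Ω φ) (Ω : Set ℝ) := d1_congr (d1_congr h)

lemma IsAC2.d2_ae_unique {ψ φ : ℝ → ℂ} (hψ : IsAC2 Ω ψ) (hφ : IsAC2 Ω φ)
    (h : ψ =ᵐ[volume.restrict (Ω : Set ℝ)] φ) :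
    d2 Ω ψ =ᵐ[volume.restrict (Ω : Set ℝ)] d2 Ω φ := by
  have h1 : EqOn ψ φ (Ω : Set ℝ) := Measure.eqOn_open_of_ae_eq h Ω.isOpen
    (hψ.diff.continuousOn.mono subset_closure) (hφ.diff.continuousOn.mono subset_closure)
  exact (ae_restrict_mem Ω.isOpen.measurableSet).mono fun x hx => d2_congr h1 hx

lemma IsAC2.ae_differentiable_d1 {ψ : ℝ → ℂ} (hψ : IsAC2 Ω ψ) :
    ∀ᵐ x ∂volume.restrict (Ω : Set ℝ),
      DifferentiableWithinAt ℝ (d1 Ω ψ) (closure (Ω : Set ℝ)) x := by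
  rw [ae_restrict_iff' Ω.isOpen.measurableSet, ae_iff]
  refine measure_null_of_locally_null _ fun x hx => ?_
  simp only [mem_ofPred_eq, Classical.not_imp] at hx
  obtain ⟨ε, hε, hball⟩ := Metric.isOpen_iff.1 Ω.isOpen x hx.1
  have hsub : uIcc (x - ε / 2) (x + ε / 2) ⊆ (Ω : Set ℝ) := by
    intro y hy
    apply hball
    rw [uIcc_of_le (by linarith)] at hy
    rw [Metric.mem_ball, Real.dist_eq, abs_lt]
    constructor <;> linarith [hy.1, hy.2]
  have hbv := (hψ.ac_d1 _ _ (hsub.trans subset_closure)).boundedVariationOn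
  have hae := hbv.ae_differentiableAt_of_mem_uIcc
  rw [ae_iff] at hae
  refine ⟨_, inter_mem_nhdsWithin _ (Icc_mem_nhds (a := x - ε / 2) (b := x + ε / 2)
    (by linarith) (by linarith)), measure_mono_null ?_ hae⟩
  rintro y ⟨hy, hy'⟩
  simp only [mem_ofPred_eq, Classical.not_imp] at hy ⊢
  refine ⟨by rwa [uIcc_of_le (by linarith)], fun hd => hy.2 hd.differentiableWithinAt⟩

lemma IsAC2.eqOn_d1_add {ψ φ : ℝ → ℂ} (hψ : IsAC2 Ω ψ) (hφ : IsAC2 Ω φ) :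
    EqOn (d1 Ω (ψ + φ)) (d1 Ω ψ + d1 Ω φ) (closure (Ω : Set ℝ)) := fun x hx =>
  derivWithin_add (hψ.diff x hx) (hφ.diff x hx)

lemma IsAC2.eqOn_d1_smul {ψ : ℝ → ℂ} (c : ℂ) (hψ : IsAC2 Ω ψ) :
    EqOn (d1 Ω (c • ψ)) (c • d1 Ω ψ) (closure (Ω : Set ℝ)) := fun x hx =>
  derivWithin_const_smul c (hψ.diff x hx)

lemma ac_congr {f g : ℝ → ℂ} {a b : ℝ} (h : EqOn f g (uIcc a b))
    (hg : AbsolutelyContinuousOnInterval g a b) : AbsolutelyContinuousOnInterval f a b := by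
  rw [absolutelyContinuousOnInterval_iff] at hg ⊢
  intro ε hε
  obtain ⟨δ, hδ, H⟩ := hg ε hε
  refine ⟨δ, hδ, fun E hE hlen => ?_⟩
  have := H E hE hlen
  rwa [Finset.sum_congr rfl fun i hi => by rw [h (hE.1 i hi).1, h (hE.1 i hi).2]]

lemma IsAC2.d2_add {ψ φ : ℝ → ℂ} (hψ : IsAC2 Ω ψ) (hφ : IsAC2 Ω φ) :
    d2 Ω (ψ + φ) =ᵐ[volume.restrict (Ω : Set ℝ)] d2 Ω ψ + d2 Ω φ := by
  filter_upwards [hψ.ae_differentiable_d1, hφ.ae_differentiable_d1,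
    ae_restrict_mem Ω.isOpen.measurableSet] with x h1 h2 hx
  have h3 : d2 Ω (ψ + φ) x = d1 Ω (d1 Ω ψ + d1 Ω φ) x :=
    derivWithin_congr (hψ.eqOn_d1_add hφ) (hψ.eqOn_d1_add hφ (subset_closure hx))
  rw [h3]
  exact derivWithin_add h1 h2

lemma IsAC2.d2_smul {ψ : ℝ → ℂ} (c : ℂ) (hψ : IsAC2 Ω ψ) :
    d2 Ω (c • ψ) =ᵐ[volume.restrict (Ω : Set ℝ)] c • d2 Ω ψ := by
  filter_upwards [hψ.ae_differentiable_d1, ae_restrict_mem Ω.isOpen.measurableSet] with x h1 hx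
  have h3 : d2 Ω (c • ψ) x = d1 Ω (c • d1 Ω ψ) x :=
    derivWithin_congr (hψ.eqOn_d1_smul c) (hψ.eqOn_d1_smul c (subset_closure hx))
  rw [h3]
  exact derivWithin_const_smul c h1

lemma IsAC2.add {ψ φ : ℝ → ℂ} (hψ : IsAC2 Ω ψ) (hφ : IsAC2 Ω φ) : IsAC2 Ω (ψ + φ) where
  ac a b h := (hψ.ac a b h).add (hφ.ac a b h)
  diff := hψ.diff.add hφ.diff
  ac_d1 a b h := ac_congr ((hψ.eqOn_d1_add hφ).mono h) ((hψ.ac_d1 a b h).add (hφ.ac_d1 a b h))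
  memLp_d2 := (memLp_congr_ae (hψ.d2_add hφ)).2 (hψ.memLp_d2.add hφ.memLp_d2)

lemma IsAC2.smul {ψ : ℝ → ℂ} (c : ℂ) (hψ : IsAC2 Ω ψ) : IsAC2 Ω (c • ψ) where
  ac a b h := (hψ.ac a b h).const_smul c
  diff := hψ.diff.const_smul c
  ac_d1 a b h := ac_congr ((hψ.eqOn_d1_smul c).mono h) ((hψ.ac_d1 a b h).const_smul c)
  memLp_d2 := (memLp_congr_ae (hψ.d2_smul c)).2 (hψ.memLp_d2.const_smul c)

lemma isAC2_of_contDiff {ψ : ℝ → ℂ} (hψ : ContDiff ℝ ∞ ψ) (hc : HasCompactSupport ψ)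
    (hs : tsupport ψ ⊆ (Ω : Set ℝ)) : IsAC2 Ω ψ := by
  have key : ∀ χ : ℝ → ℂ, ContDiff ℝ ∞ χ → tsupport χ ⊆ (Ω : Set ℝ) → d1 Ω χ = deriv χ := by
    intro χ hχ hsχ
    funext x
    by_cases hx : x ∈ (Ω : Set ℝ)
    · exact derivWithin_of_mem_nhds
        (Filter.mem_of_superset (Ω.isOpen.mem_nhds hx) subset_closure)
    · have h0 : χ =ᶠ[nhds x] fun _ => 0 := notMem_tsupport_iff_eventuallyEq.1 fun h => hx (hsχ h)
      rw [h0.deriv_eq, d1, (h0.filter_mono nhdsWithin_le_nhds).derivWithin_eq h0.eq_of_nhds]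
      simp
  have h1 : ContDiff ℝ ∞ (deriv ψ) := ContDiff.deriv' hψ
  have h2 : ContDiff ℝ ∞ (deriv (deriv ψ)) := ContDiff.deriv' h1
  have e1 : d1 Ω ψ = deriv ψ := key ψ hψ hs
  have e2 : d2 Ω ψ = deriv (deriv ψ) := by
    rw [d2, e1]
    exact key _ h1 (tsupport_deriv_subset.trans hs)
  refine ⟨fun a b _ => ?_, (hψ.differentiable (by simp)).differentiableOn, fun a b _ => ?_, ?_⟩
  · exact (hψ.of_le (by simp)).contDiffOn.absolutelyContinuousOnInterval
  · rw [e1]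
    exact (h1.of_le (by simp)).contDiffOn.absolutelyContinuousOnInterval
  · rw [e2]
    exact (h2.continuous.memLp_of_hasCompactSupport hc.deriv.deriv).restrict _

lemma isAC2_zero : IsAC2 Ω (0 : ℝ → ℂ) :=
  isAC2_of_contDiff contDiff_const HasCompactSupport.zero (by simp [tsupport])

/-- The elements of `L²(Ω)` that have a representative of class `AC²` on the closure of `Ω`. -/
def ac2Domain (Ω : TopologicalSpace.Opens ℝ) : Submodule ℂ (L2 Ω) where
  carrier := {f | ∃ ψ : ℝ → ℂ, IsAC2 Ω ψ ∧ f =ᵐ[volume.restrict (Ω : Set ℝ)] ψ}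
  zero_mem' := ⟨0, isAC2_zero, Lp.coeFn_zero _ _ _⟩
  add_mem' := by
    rintro f g ⟨ψ, hψ, hf⟩ ⟨φ, hφ, hg⟩
    exact ⟨ψ + φ, hψ.add hφ, (Lp.coeFn_add f g).trans (hf.add hg)⟩
  smul_mem' := by
    rintro c f ⟨ψ, hψ, hf⟩
    exact ⟨c • ψ, hψ.smul c, (Lp.coeFn_smul c f).trans (hf.const_smul c)⟩

/-- `-ψ''` as an element of `L²(Ω)`, for the `AC²` representative `ψ` of `f`. -/
def negSecondDeriv (f : ac2Domain Ω) : L2 Ω :=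
  -(f.2.choose_spec.1.memLp_d2.toLp (d2 Ω f.2.choose))

lemma negSecondDeriv_ae (f : ac2Domain Ω) {ψ : ℝ → ℂ} (hψ : IsAC2 Ω ψ)
    (h : (f : L2 Ω) =ᵐ[volume.restrict (Ω : Set ℝ)] ψ) :
    negSecondDeriv f =ᵐ[volume.restrict (Ω : Set ℝ)] fun x => -d2 Ω ψ x := by
  have h1 := f.2.choose_spec.1.d2_ae_unique hψ (f.2.choose_spec.2.symm.trans h)
  refine (Lp.coeFn_neg _).trans ?_
  filter_upwards [f.2.choose_spec.1.memLp_d2.coeFn_toLp, h1] with x hx hx'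
  rw [Pi.neg_apply, hx, hx']

/-- The operator `-d²/dx²` in `L²(Ω)` on its maximal domain `AC²`, with no boundary condition. -/
def maxOperator (Ω : TopologicalSpace.Opens ℝ) : L2 Ω →ₗ.[ℂ] L2 Ω where
  domain := ac2Domain Ω
  toFun :=
    { toFun := negSecondDeriv
      map_add' := by
        intro f g
        obtain ⟨ψ, hψ, hf⟩ := f.2
        obtain ⟨φ, hφ, hg⟩ := g.2
        apply Lp.ext
        have h := negSecondDeriv_ae (f + g) (hψ.add hφ)
          ((Lp.coeFn_add (f : L2 Ω) (g : L2 Ω)).trans (hf.add hg))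
        refine h.trans (Filter.EventuallyEq.trans ?_ (Lp.coeFn_add _ _).symm)
        filter_upwards [negSecondDeriv_ae f hψ hf, negSecondDeriv_ae g hφ hg, hψ.d2_add hφ]
          with x h1 h2 h3
        rw [Pi.add_apply, h1, h2, h3, Pi.add_apply]
        ring
      map_smul' := by
        intro c f
        obtain ⟨ψ, hψ, hf⟩ := f.2
        apply Lp.ext
        have h := negSecondDeriv_ae (c • f) (hψ.smul c)
          ((Lp.coeFn_smul c (f : L2 Ω)).trans (hf.const_smul c))
        refine h.trans (Filter.EventuallyEq.trans ?_ (Lp.coeFn_smul _ _).symm)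
        filter_upwards [negSecondDeriv_ae f hψ hf, hψ.d2_smul c] with x h1 h3
        simp only [RingHom.id_apply, Pi.smul_apply] at h3 ⊢
        rw [h1, h3, smul_neg] }

/-! ### The minimal operator -/

/-- `C₀^∞(Ω)`, as a subspace of `L²(Ω)`. -/
def testFunctions (Ω : TopologicalSpace.Opens ℝ) : Submodule ℂ (L2 Ω) where
  carrier := {f | ∃ φ : ℝ → ℂ, ContDiff ℝ ∞ φ ∧ HasCompactSupport φ ∧
    tsupport φ ⊆ (Ω : Set ℝ) ∧ f =ᵐ[volume.restrict (Ω : Set ℝ)] φ}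
  zero_mem' := ⟨0, contDiff_const, HasCompactSupport.zero, by simp [tsupport],
    Lp.coeFn_zero _ _ _⟩
  add_mem' := by
    rintro f g ⟨ψ, h1, h2, h3, hf⟩ ⟨φ, k1, k2, k3, hg⟩
    exact ⟨ψ + φ, h1.add k1, h2.add k2, (tsupport_add ψ φ).trans (union_subset h3 k3),
      (Lp.coeFn_add f g).trans (hf.add hg)⟩
  smul_mem' := by
    rintro c f ⟨ψ, h1, h2, h3, hf⟩
    exact ⟨c • ψ, h1.const_smul c, h2.smul_left (f := fun _ => c),
      (tsupport_smul_subset_right (fun _ => c) ψ).trans h3,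
      (Lp.coeFn_smul c f).trans (hf.const_smul c)⟩

/-- `H₀₀ = -d²/dx²` with domain `C₀^∞(Ω_Λ)`. -/
def H00 (Λ : ℝ) : L2 (islands Λ) →ₗ.[ℂ] L2 (islands Λ) :=
  (maxOperator (islands Λ)).domRestrict (testFunctions (islands Λ))

lemma H00_domain (Λ : ℝ) : (H00 Λ).domain = testFunctions (islands Λ) :=
  inf_eq_left.2 fun _ ⟨φ, h1, h2, h3, hf⟩ => ⟨φ, isAC2_of_contDiff h1 h2 h3, hf⟩

/-- `H₀`, the closure of `H₀₀`. -/
def H0 (Λ : ℝ) : L2 (islands Λ) →ₗ.[ℂ] L2 (islands Λ) := (H00 Λ).closure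

/-- `B` is a self-adjoint extension of `A`. -/
def IsSelfAdjointExtension {E : Type*} [NormedAddCommGroup E] [InnerProductSpace ℂ E]
    [CompleteSpace E] (A B : E →ₗ.[ℂ] E) : Prop :=
  A ≤ B ∧ IsSelfAdjoint B

/-! ### The functions `L_±`, `R_±` and the operator `H_γ` -/

/-- The normalization factor `N = 2^{1/4} e^{Λ/√2}`. -/
def normFactor (Λ : ℝ) : ℂ := (((2 : ℝ) ^ (1 / 4 : ℝ) * Real.exp (Λ / √2) : ℝ) : ℂ)

/-- `L_+`: `N e^{(1-i)x/√2}` on the left island and `0` on the right one. -/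
def LplusFun (Λ : ℝ) : ℝ → ℂ := (Iio (-Λ)).indicator fun x =>
  normFactor Λ * Complex.exp ((1 - Complex.I) * x / (√2 : ℝ))

/-- `L_-`: `N e^{(1+i)x/√2}` on the left island and `0` on the right one. -/
def LminusFun (Λ : ℝ) : ℝ → ℂ := (Iio (-Λ)).indicator fun x =>
  normFactor Λ * Complex.exp ((1 + Complex.I) * x / (√2 : ℝ))

/-- `R_+`: `0` on the left island and `N e^{(-1+i)x/√2}` on the right one. -/
def RplusFun (Λ : ℝ) : ℝ → ℂ := (Ioi Λ).indicator fun x =>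
  normFactor Λ * Complex.exp ((-1 + Complex.I) * x / (√2 : ℝ))

/-- `R_-`: `0` on the left island and `N e^{(-1-i)x/√2}` on the right one. -/
def RminusFun (Λ : ℝ) : ℝ → ℂ := (Ioi Λ).indicator fun x =>
  normFactor Λ * Complex.exp ((-1 - Complex.I) * x / (√2 : ℝ))

lemma norm_cexp_sq (z : ℂ) (x : ℝ) :
    ‖Complex.exp (z * x / (√2 : ℝ))‖ ^ 2 = Real.exp (2 * z.re / √2 * x) := by
  have h : (z * x / (√2 : ℝ)).re = z.re * x / √2 := by
    rw [Complex.div_ofReal_re, Complex.re_mul_ofReal]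
  rw [Complex.norm_exp, h, ← Real.exp_nat_mul]
  congr 1
  push_cast
  ring

lemma memLp_exp_left (c z : ℂ) (a : ℝ) (hz : 0 < z.re) (μ : Measure ℝ) (hμ : μ ≤ volume) :
    MemLp ((Iio a).indicator fun x : ℝ => c * Complex.exp (z * x / (√2 : ℝ))) 2 μ := by
  refine MemLp.mono_measure hμ ?_
  rw [memLp_indicator_iff_restrict measurableSet_Iio]
  refine MemLp.const_mul ?_ c
  rw [memLp_two_iff_integrable_sq_norm (by fun_prop)]
  simp_rw [norm_cexp_sq]
  exact (integrableOn_exp_mul_Iic (a := 2 * z.re / √2) (by positivity) a).mono_set Iio_subset_Iic_self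

lemma memLp_exp_right (c z : ℂ) (a : ℝ) (hz : z.re < 0) (μ : Measure ℝ) (hμ : μ ≤ volume) :
    MemLp ((Ioi a).indicator fun x : ℝ => c * Complex.exp (z * x / (√2 : ℝ))) 2 μ := by
  refine MemLp.mono_measure hμ ?_
  rw [memLp_indicator_iff_restrict measurableSet_Ioi]
  refine MemLp.const_mul ?_ c
  rw [memLp_two_iff_integrable_sq_norm (by fun_prop)]
  simp_rw [norm_cexp_sq]
  exact integrableOn_exp_mul_Ioi
    (div_neg_of_neg_of_pos (by linarith) (Real.sqrt_pos.2 two_pos)) a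

/-- `L_+` as a vector of `L²(Ω_Λ)`. -/
def Lplus (Λ : ℝ) : L2 (islands Λ) :=
  MemLp.toLp (LplusFun Λ) (memLp_exp_left _ _ _ (by simp) _ Measure.restrict_le_self)

/-- `L_-` as a vector of `L²(Ω_Λ)`. -/
def Lminus (Λ : ℝ) : L2 (islands Λ) :=
  MemLp.toLp (LminusFun Λ) (memLp_exp_left _ _ _ (by simp) _ Measure.restrict_le_self)

/-- `R_+` as a vector of `L²(Ω_Λ)`. -/
def Rplus (Λ : ℝ) : L2 (islands Λ) :=
  MemLp.toLp (RplusFun Λ) (memLp_exp_right _ _ _ (by simp) _ Measure.restrict_le_self)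

/-- `R_-` as a vector of `L²(Ω_Λ)`. -/
def Rminus (Λ : ℝ) : L2 (islands Λ) :=
  MemLp.toLp (RminusFun Λ) (memLp_exp_right _ _ _ (by simp) _ Measure.restrict_le_self)

/-- The vectors `ψ₀ + c_L (L_+ + γ_L L_-) + c_R (R_+ + γ_R R_-)` with `ψ₀ ∈ D(H₀)` and
`c_L, c_R ∈ ℂ`. -/
def gammaDomain (Λ : ℝ) (γL γR : ℂ) : Submodule ℂ (L2 (islands Λ)) where
  carrier := {f | ∃ ψ₀ ∈ (H0 Λ).domain, ∃ cL cR : ℂ,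
    f = ψ₀ + cL • (Lplus Λ + γL • Lminus Λ) + cR • (Rplus Λ + γR • Rminus Λ)}
  zero_mem' := ⟨0, zero_mem _, 0, 0, by simp⟩
  add_mem' := by
    rintro f g ⟨f₀, hf, a, b, rfl⟩ ⟨g₀, hg, a', b', rfl⟩
    exact ⟨f₀ + g₀, add_mem hf hg, a + a', b + b', by module⟩
  smul_mem' := by
    rintro c f ⟨f₀, hf, a, b, rfl⟩
    exact ⟨c • f₀, Submodule.smul_mem _ c hf, c * a, c * b, by module⟩

/-- `H_γ = -d²/dx²` on the domain `gammaDomain`. (`domRestrict` intersects this space with the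
maximal domain; that nothing is lost is part of the theorem.) -/
def Hgamma (Λ : ℝ) (γL γR : ℂ) : L2 (islands Λ) →ₗ.[ℂ] L2 (islands Λ) :=
  (maxOperator (islands Λ)).domRestrict (gammaDomain Λ γL γR)

/-- The phase `e^{i(θ + √2 Λ)}`. -/
def phase (Λ θ : ℝ) : ℂ := Complex.exp (Complex.I * ((θ + √2 * Λ : ℝ) : ℂ))

/-! ### Separated boundary conditions and the operators `H_α` -/

/-- The boundary condition with parameter `α ∈ ℝ ∪ {∞}` at the boundary point `p` of `Ω`:
`ψ'(p) = α ψ(p)` for real `α`, and `ψ(p) = 0` for `α = ∞`. -/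
def BoundaryCondition (Ω : TopologicalSpace.Opens ℝ) (p : ℝ) (α : OnePoint ℝ)
    (ψ : ℝ → ℂ) : Prop :=
  (∀ a : ℝ, α = (a : OnePoint ℝ) → d1 Ω ψ p = (a : ℂ) * ψ p) ∧ (α = OnePoint.infty → ψ p = 0)

/-- The elements of `L²(Ω)` whose `AC²` representative satisfies the boundary condition with
parameter `α` at `p`, for every pair `(p, α)` in `bc`. -/
def boundaryDomain (Ω : TopologicalSpace.Opens ℝ) (bc : Set (ℝ × OnePoint ℝ)) :
    Submodule ℂ (L2 Ω) where
  carrier := {f | ∃ ψ : ℝ → ℂ, IsAC2 Ω ψ ∧ f =ᵐ[volume.restrict (Ω : Set ℝ)] ψ ∧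
    ∀ q ∈ bc, BoundaryCondition Ω q.1 q.2 ψ}
  zero_mem' := ⟨0, isAC2_zero, Lp.coeFn_zero _ _ _, fun q _ => by
    constructor <;> simp [d1]⟩
  add_mem' := by
    rintro f g ⟨ψ, hψ, hf, h⟩ ⟨φ, hφ, hg, k⟩
    refine ⟨ψ + φ, hψ.add hφ, (Lp.coeFn_add f g).trans (hf.add hg), fun q hq => ⟨?_, ?_⟩⟩
    · intro a ha
      have e1 := (h q hq).1 a ha
      have e2 := (k q hq).1 a ha
      by_cases hp : q.1 ∈ closure (Ω : Set ℝ)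
      · rw [hψ.eqOn_d1_add hφ hp, Pi.add_apply, Pi.add_apply, e1, e2]
        ring
      · have z : ∀ χ : ℝ → ℂ, d1 Ω χ q.1 = 0 := fun χ =>
          derivWithin_zero_of_notMem_closure (by rwa [closure_closure])
        rw [z] at e1 e2 ⊢
        rw [Pi.add_apply, mul_add, ← e1, ← e2, add_zero]
    · intro ha
      rw [Pi.add_apply, (h q hq).2 ha, (k q hq).2 ha, add_zero]
  smul_mem' := by
    rintro c f ⟨ψ, hψ, hf, h⟩
    refine ⟨c • ψ, hψ.smul c, (Lp.coeFn_smul c f).trans (hf.const_smul c), fun q hq => ⟨?_, ?_⟩⟩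
    · intro a ha
      have e1 := (h q hq).1 a ha
      by_cases hp : q.1 ∈ closure (Ω : Set ℝ)
      · rw [hψ.eqOn_d1_smul c hp, Pi.smul_apply, Pi.smul_apply, e1, smul_eq_mul, smul_eq_mul]
        ring
      · have z : ∀ χ : ℝ → ℂ, d1 Ω χ q.1 = 0 := fun χ =>
          derivWithin_zero_of_notMem_closure (by rwa [closure_closure])
        rw [z] at e1 ⊢
        rw [Pi.smul_apply, smul_eq_mul, mul_left_comm, ← e1, mul_zero]
    · intro ha
      rw [Pi.smul_apply, (h q hq).2 ha, smul_zero]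

/-- `-d²/dx²` on `boundaryDomain`. -/
def boundaryOperator (Ω : TopologicalSpace.Opens ℝ) (bc : Set (ℝ × OnePoint ℝ)) :
    L2 Ω →ₗ.[ℂ] L2 Ω :=
  (maxOperator Ω).domRestrict (boundaryDomain Ω bc)

lemma boundaryOperator_domain (Ω : TopologicalSpace.Opens ℝ) (bc : Set (ℝ × OnePoint ℝ)) :
    (boundaryOperator Ω bc).domain = boundaryDomain Ω bc :=
  inf_eq_left.2 fun _ ⟨ψ, hψ, hf, _⟩ => ⟨ψ, hψ, hf⟩

/-- `H_α` in `L²(Ω_Λ)`, `α = (α_L, α_R)`. -/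
def Halpha (Λ : ℝ) (αL αR : OnePoint ℝ) : L2 (islands Λ) →ₗ.[ℂ] L2 (islands Λ) :=
  boundaryOperator (islands Λ) {(-Λ, αL), (Λ, αR)}

/-- `H_{α_L}` in `L²(Ω_L)`. -/
def HalphaLeft (Λ : ℝ) (αL : OnePoint ℝ) : L2 (leftIsland Λ) →ₗ.[ℂ] L2 (leftIsland Λ) :=
  boundaryOperator (leftIsland Λ) {(-Λ, αL)}

/-- `H_{α_R}` in `L²(Ω_R)`. -/
def HalphaRight (Λ : ℝ) (αR : OnePoint ℝ) : L2 (rightIsland Λ) →ₗ.[ℂ] L2 (rightIsland Λ) :=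
  boundaryOperator (rightIsland Λ) {(Λ, αR)}

open Classical in
/-- `α_L` as a function of `θ_L`. -/
def alphaLeft (θ : ℝ) : OnePoint ℝ :=
  if θ = Real.pi then OnePoint.infty
  else (((1 + Real.cos θ - Real.sin θ) / (√2 * (1 + Real.cos θ)) : ℝ) : OnePoint ℝ)

open Classical in
/-- `α_R` as a function of `θ_R`. -/
def alphaRight (θ : ℝ) : OnePoint ℝ :=
  if θ = Real.pi then OnePoint.infty
  else ((-((1 + Real.cos θ - Real.sin θ) / (√2 * (1 + Real.cos θ))) : ℝ) : OnePoint ℝ)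

/-! ### Direct sums -/

/-- The direct sum `A ⊕ B` on the Hilbert space direct sum, with domain `D(A) ⊕ D(B)`. -/
def directSum {E F : Type*} [NormedAddCommGroup E] [InnerProductSpace ℂ E]
    [NormedAddCommGroup F] [InnerProductSpace ℂ F] (A : E →ₗ.[ℂ] E) (B : F →ₗ.[ℂ] F) :
    WithLp 2 (E × F) →ₗ.[ℂ] WithLp 2 (E × F) where
  domain :=
    { carrier := {p | p.fst ∈ A.domain ∧ p.snd ∈ B.domain}
      zero_mem' := ⟨zero_mem _, zero_mem _⟩
      add_mem' := fun h k => ⟨add_mem h.1 k.1, add_mem h.2 k.2⟩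
      smul_mem' := fun c _ h => ⟨Submodule.smul_mem _ c h.1, Submodule.smul_mem _ c h.2⟩ }
  toFun :=
    { toFun := fun p => WithLp.toLp 2 (A ⟨p.1.fst, p.2.1⟩, B ⟨p.1.snd, p.2.2⟩)
      map_add' := fun p q => by
        rw [← WithLp.toLp_add, Prod.mk_add_mk, ← LinearPMap.map_add, ← LinearPMap.map_add]
        rfl
      map_smul' := fun c p => by
        rw [RingHom.id_apply, ← WithLp.toLp_smul, Prod.smul_mk, ← LinearPMap.map_smul,
          ← LinearPMap.map_smul]
        rfl }

/-- The unitary map `U` transforms `A` into `B`: `U D(A) = D(B)` and `U A f = B U f`. -/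
def Intertwines {E F : Type*} [NormedAddCommGroup E] [InnerProductSpace ℂ E]
    [NormedAddCommGroup F] [InnerProductSpace ℂ F] (U : E ≃ₗᵢ[ℂ] F)
    (A : E →ₗ.[ℂ] E) (B : F →ₗ.[ℂ] F) : Prop :=
  ∀ f g : E, (f, g) ∈ A.graph ↔ (U f, U g) ∈ B.graph

end Junction

end

/-! A function of class `H²` on a closed region is handled as a triple `(u, p, q)` in which `p` is
a primitive of `q` and `u` a primitive of `p`. A function that is weakly twice differentiable with
second derivative `q` differs from a double primitive of `q` by an affine function on each
interval, so the adjoint of the minimal operator is the maximal operator. Green's identity has no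
contribution from infinity, because there the `L²` functions tend to zero along an ultrafilter
while their derivatives stay bounded. Hence the adjoint of the restriction of the maximal operator
to a space of boundary data `(ψ(∓Λ), ψ'(∓Λ)) ∈ ℂ² × ℂ²` is its restriction to the
Wronskian-orthogonal complement of that space, and a Robin line `ψ' = α ψ` is its own complement:
this is the self-adjointness of `H_α`.

The boundary data of `L_+ + γ_L L_-` are a multiple of the real vector
`(cos (θ/2), (cos (θ/2) - sin (θ/2)) / √2)`, which spans the Robin line of `α_L`. As `D(H₀)` is
the space of functions with vanishing boundary data, it follows that `H_γ = H_α`. The right island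
is the reflection of the left one. -/

noncomputable section

namespace Junction

open Filter Topology

/-! ### Primitives and functions of class `H²` -/

section Primitives

variable {E F : Type*} [NormedAddCommGroup E] [NormedSpace ℝ E]
  [NormedAddCommGroup F] [NormedSpace ℝ F]

lemma absolutelyContinuousOnInterval_intervalIntegral {f : ℝ → E} {a b c : ℝ}
    (hf : IntervalIntegrable f volume a b) (hc : c ∈ uIcc a b) :
    AbsolutelyContinuousOnInterval (fun x => ∫ t in c..x, f t) a b := by
  have hnorm := hf.norm.absolutelyContinuousOnInterval_intervalIntegral hc
  have dist_le : ∀ x ∈ uIcc a b, ∀ y ∈ uIcc a b,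
      dist (∫ t in c..x, f t) (∫ t in c..y, f t) ≤
        dist (∫ t in c..x, ‖f t‖) (∫ t in c..y, ‖f t‖) := by
    intro x hx y hy
    have hint : ∀ z ∈ uIcc a b, IntervalIntegrable f volume c z := fun z hz =>
      hf.mono_set (uIcc_subset_uIcc hc hz)
    rw [dist_eq_norm, Real.dist_eq, intervalIntegral.integral_interval_sub_left (hint x hx)
      (hint y hy), intervalIntegral.integral_interval_sub_left (hint x hx).norm (hint y hy).norm]
    exact intervalIntegral.norm_integral_le_abs_integral_norm
  rw [absolutelyContinuousOnInterval_iff] at hnorm ⊢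
  intro ε hε
  obtain ⟨δ, hδ, h⟩ := hnorm ε hε
  refine ⟨δ, hδ, fun I hI hlen => (Finset.sum_le_sum fun i hi => ?_).trans_lt (h I hI hlen)⟩
  exact dist_le _ (hI.1 i hi).1 _ (hI.1 i hi).2

lemma ae_uIcc_mem_nhds (a b : ℝ) : ∀ᵐ x, x ∈ uIcc a b → uIcc a b ∈ 𝓝 x := by
  filter_upwards [Measure.ae_ne volume (min a b), Measure.ae_ne volume (max a b)] with x ha hb hx
  exact Icc_mem_nhds (lt_of_le_of_ne hx.1 ha.symm) (lt_of_le_of_ne hx.2 hb)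

/-- `f'` is integrable on every compact interval contained in `S`, and `f` is a primitive of `f'`
on each of them. The second requirement is the integral form of the fundamental theorem of
calculus, so that `f` need not be differentiable everywhere. -/
structure IsPrimitiveOn (S : Set ℝ) (f f' : ℝ → E) : Prop where
  intervalIntegrable : ∀ a b : ℝ, uIcc a b ⊆ S → IntervalIntegrable f' volume a b
  integral_eq_sub : ∀ a b : ℝ, uIcc a b ⊆ S → ∫ t in a..b, f' t = f b - f a

namespace IsPrimitiveOn

variable {S T : Set ℝ} {f f' g g' : ℝ → E} {a b : ℝ}

lemma mono (hf : IsPrimitiveOn S f f') (hT : T ⊆ S) : IsPrimitiveOn T f f' :=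
  ⟨fun a b h => hf.1 a b (h.trans hT), fun a b h => hf.2 a b (h.trans hT)⟩

lemma congr_ae (hf : IsPrimitiveOn S f f') (h : EqOn g f S)
    (h' : g' =ᵐ[volume.restrict S] f') : IsPrimitiveOn S g g' := by
  have key : ∀ a b : ℝ, uIcc a b ⊆ S → f' =ᵐ[volume.restrict (uIoc a b)] g' := fun a b hab =>
    EventuallyEq.symm (ae_restrict_of_ae_restrict_of_subset (uIoc_subset_uIcc.trans hab) h')
  refine ⟨fun a b hab => (hf.1 a b hab).congr_ae (key a b hab), fun a b hab => ?_⟩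
  rw [h (hab left_mem_uIcc), h (hab right_mem_uIcc), ← hf.2 a b hab]
  exact (intervalIntegral.integral_congr_ae_restrict (key a b hab)).symm

lemma eq_add_integral (hf : IsPrimitiveOn S f f') (hab : uIcc a b ⊆ S) :
    f b = f a + ∫ t in a..b, f' t := by
  rw [hf.2 a b hab, add_sub_cancel]

lemma absolutelyContinuousOnInterval (hf : IsPrimitiveOn S f f') (hab : uIcc a b ⊆ S) :
    AbsolutelyContinuousOnInterval f a b := by
  have hint := absolutelyContinuousOnInterval_intervalIntegral (hf.1 a b hab)
    (left_mem_uIcc (a := a) (b := b))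
  rw [absolutelyContinuousOnInterval_iff] at hint ⊢
  intro ε hε
  obtain ⟨δ, hδ, h⟩ := hint ε hε
  refine ⟨δ, hδ, fun I hI hlen => (Finset.sum_congr rfl fun i hi => ?_).trans_lt (h I hI hlen)⟩
  have heq : ∀ x ∈ uIcc a b, f x = f a + ∫ t in a..x, f' t := fun x hx =>
    hf.eq_add_integral ((uIcc_subset_uIcc_left hx).trans hab)
  rw [heq _ (hI.1 i hi).1, heq _ (hI.1 i hi).2, dist_add_left]

lemma continuousOn_uIcc (hf : IsPrimitiveOn S f f') (hab : uIcc a b ⊆ S) :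
    ContinuousOn f (uIcc a b) :=
  (hf.absolutelyContinuousOnInterval hab).continuousOn

lemma ae_hasDerivAt [CompleteSpace E] (hf : IsPrimitiveOn S f f') (hab : uIcc a b ⊆ S) :
    ∀ᵐ x, x ∈ uIcc a b → HasDerivAt f (f' x) x := by
  filter_upwards [(hf.1 a b hab).ae_hasDerivAt_integral, ae_uIcc_mem_nhds a b]
    with x hderiv hnhds hx
  refine ((hderiv hx a left_mem_uIcc).const_add (f a)).congr_of_eventuallyEq ?_
  filter_upwards [hnhds hx] with y hy
  exact hf.eq_add_integral ((uIcc_subset_uIcc_left hy).trans hab)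

lemma of_ae_hasDerivAt [CompleteSpace E]
    (hac : ∀ a b : ℝ, uIcc a b ⊆ S → AbsolutelyContinuousOnInterval f a b)
    (hint : ∀ a b : ℝ, uIcc a b ⊆ S → IntervalIntegrable f' volume a b)
    (hderiv : ∀ a b : ℝ, uIcc a b ⊆ S → ∀ᵐ x, x ∈ uIcc a b → HasDerivAt f (f' x) x) :
    IsPrimitiveOn S f f' := by
  refine ⟨hint, fun a b hab => ?_⟩
  have hdiff := (hac a b hab).sub (absolutelyContinuousOnInterval_intervalIntegral
    (hint a b hab) (left_mem_uIcc (a := a) (b := b)))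
  obtain ⟨C, hC⟩ := hdiff.const_of_ae_hasDerivAt_zero (by
    filter_upwards [hderiv a b hab, (hint a b hab).ae_hasDerivAt_integral] with x hf hI hx
    simpa only [sub_self] using (hf hx).sub (hI hx a left_mem_uIcc))
  have ha := hC a left_mem_uIcc
  have hb := hC b right_mem_uIcc
  simp only [Pi.sub_apply, intervalIntegral.integral_same, sub_zero] at ha hb
  rw [ha, ← hb, sub_sub_cancel]

lemma of_hasDerivAt [CompleteSpace E] (hf : ∀ x, HasDerivAt f (f' x) x) (hf' : Continuous f') :
    IsPrimitiveOn S f f' :=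
  ⟨fun a b _ => hf'.intervalIntegrable a b, fun a b _ =>
    intervalIntegral.integral_eq_sub_of_hasDerivAt (fun x _ => hf x) (hf'.intervalIntegrable a b)⟩

lemma add (hf : IsPrimitiveOn S f f') (hg : IsPrimitiveOn S g g') :
    IsPrimitiveOn S (f + g) (f' + g') :=
  ⟨fun a b h => (hf.1 a b h).add (hg.1 a b h), fun a b h => by
    simp only [Pi.add_apply]
    rw [intervalIntegral.integral_add (hf.1 a b h) (hg.1 a b h), hf.2 a b h, hg.2 a b h,
      add_sub_add_comm]⟩

lemma clm_comp [CompleteSpace E] [CompleteSpace F] (L : E →L[ℝ] F) (hf : IsPrimitiveOn S f f') :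
    IsPrimitiveOn S (fun x => L (f x)) fun x => L (f' x) :=
  ⟨fun a b h => ⟨L.integrable_comp (hf.1 a b h).1, L.integrable_comp (hf.1 a b h).2⟩,
    fun a b h => by rw [L.intervalIntegral_comp_comm (hf.1 a b h), hf.2 a b h, map_sub]⟩

lemma sub (hf : IsPrimitiveOn S f f') (hg : IsPrimitiveOn S g g') :
    IsPrimitiveOn S (f - g) (f' - g') :=
  ⟨fun a b h => (hf.1 a b h).sub (hg.1 a b h), fun a b h => by
    simp only [Pi.sub_apply]
    rw [intervalIntegral.integral_sub (hf.1 a b h) (hg.1 a b h), hf.2 a b h, hg.2 a b h,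
      sub_sub_sub_comm]⟩

lemma comp_neg (hf : IsPrimitiveOn S f f') :
    IsPrimitiveOn (Neg.neg ⁻¹' S) (fun x => f (-x)) fun x => -f' (-x) := by
  have uIcc_neg_subset : ∀ a b : ℝ, uIcc a b ⊆ Neg.neg ⁻¹' S → uIcc (-a) (-b) ⊆ S := by
    intro a b h
    rw [← image_neg_uIcc]
    rintro _ ⟨x, hx, rfl⟩
    exact h hx
  refine ⟨fun a b h => ?_, fun a b h => ?_⟩
  · have hint := ((IntervalIntegrable.iff_comp_neg).1 (hf.1 _ _ (uIcc_neg_subset a b h))).neg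
    simp only [neg_neg] at hint
    exact hint
  · rw [intervalIntegral.integral_neg, intervalIntegral.integral_comp_neg,
      intervalIntegral.integral_symm, hf.2 _ _ (uIcc_neg_subset a b h), neg_neg]

lemma union (hS : IsClosed S) (hT : IsClosed T) (hST : Disjoint S T)
    (hfS : IsPrimitiveOn S f f') (hfT : IsPrimitiveOn T f f') : IsPrimitiveOn (S ∪ T) f f' := by
  have subset_or : ∀ a b : ℝ, uIcc a b ⊆ S ∪ T → uIcc a b ⊆ S ∨ uIcc a b ⊆ T := fun a b h =>
    isPreconnected_iff_subset_of_disjoint_closed.1 isPreconnected_uIcc S T hS hT h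
      (by rw [hST.inter_eq, inter_empty])
  exact ⟨fun a b h => (subset_or a b h).elim (hfS.1 a b) (hfT.1 a b),
    fun a b h => (subset_or a b h).elim (hfS.2 a b) (hfT.2 a b)⟩

lemma piecewise {A : Set ℝ} [DecidablePred (· ∈ A)] (hS : IsClosed S) (hT : IsClosed T)
    (hSA : S ⊆ A) (hTA : Disjoint T A) (hf : IsPrimitiveOn S f f') (hg : IsPrimitiveOn T g g') :
    IsPrimitiveOn (S ∪ T) (A.piecewise f g) (A.piecewise f' g') := by
  have eqOn_left : ∀ φ χ : ℝ → E, EqOn (A.piecewise φ χ) φ S := fun φ χ x hx =>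
    A.piecewise_eq_of_mem φ χ (hSA hx)
  have eqOn_right : ∀ φ χ : ℝ → E, EqOn (A.piecewise φ χ) χ T := fun φ χ x hx =>
    A.piecewise_eq_of_notMem φ χ (disjoint_left.1 hTA hx)
  exact union hS hT (hTA.symm.mono_left hSA)
    (hf.congr_ae (eqOn_left f g) (ae_restrict_of_forall_mem hS.measurableSet (eqOn_left f' g')))
    (hg.congr_ae (eqOn_right f g) (ae_restrict_of_forall_mem hT.measurableSet (eqOn_right f' g')))

lemma hasDerivWithinAt_Icc [CompleteSpace E] (hf : IsPrimitiveOn S f f') {x : ℝ}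
    (hab : Icc a b ⊆ S) (hx : x ∈ Icc a b) (hf' : ContinuousOn f' (Icc a b)) :
    HasDerivWithinAt f (f' x) (Icc a b) x := by
  have heq : ∀ y ∈ Icc a b, uIcc a y ⊆ S := fun y hy => by
    rw [uIcc_of_le hy.1]; exact (Icc_subset_Icc_right hy.2).trans hab
  have : Fact (x ∈ Icc a b) := ⟨hx⟩
  have hderiv := (intervalIntegral.integral_hasDerivWithinAt_right (s := Icc a b)
    (hf.1 a x (heq x hx)) (hf'.stronglyMeasurableAtFilter_nhdsWithin measurableSet_Icc x)
    (hf' x hx)).const_add (f a)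
  exact hderiv.congr (fun y hy => hf.eq_add_integral (heq y hy)) (hf.eq_add_integral (heq x hx))

lemma mul {f f' g g' : ℝ → ℂ} (hf : IsPrimitiveOn S f f') (hg : IsPrimitiveOn S g g') :
    IsPrimitiveOn S (f * g) (f' * g + f * g') := by
  refine of_ae_hasDerivAt (fun a b h => (hf.absolutelyContinuousOnInterval h).smul
    (hg.absolutelyContinuousOnInterval h)) (fun a b h => ?_) fun a b h => ?_
  · exact ((hf.1 a b h).mul_continuousOn (hg.continuousOn_uIcc h)).add
      ((hg.1 a b h).continuousOn_mul (hf.continuousOn_uIcc h))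
  · filter_upwards [hf.ae_hasDerivAt h, hg.ae_hasDerivAt h] with x hfx hgx hx
    exact (hfx hx).mul (hgx hx)

end IsPrimitiveOn

lemma isPrimitiveOn_intervalIntegral {S : Set ℝ} [S.OrdConnected] {f : ℝ → E} {c : ℝ}
    (hc : c ∈ S) (hf : ∀ a b : ℝ, uIcc a b ⊆ S → IntervalIntegrable f volume a b) :
    IsPrimitiveOn S (fun x => ∫ t in c..x, f t) f := by
  have hint : ∀ x ∈ S, IntervalIntegrable f volume c x := fun x hx =>
    hf c x (OrdConnected.uIcc_subset ‹_› hc hx)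
  exact ⟨hf, fun a b h => (intervalIntegral.integral_interval_sub_left
    (hint b (h right_mem_uIcc)) (hint a (h left_mem_uIcc))).symm⟩

end Primitives

lemma intervalIntegrable_of_memLp {E : Type*} [NormedAddCommGroup E] {S : Set ℝ}
    (hS : S =ᵐ[volume] closure S) {f : ℝ → E} (hf : MemLp f 2 (volume.restrict S))
    {a b : ℝ} (hab : uIcc a b ⊆ closure S) :
    IntervalIntegrable f volume a b := by
  rw [Measure.restrict_congr_set hS] at hf
  have : IsFiniteMeasure (volume.restrict (uIcc a b)) :=
    isFiniteMeasure_restrict.2 isCompact_uIcc.measure_lt_top.ne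
  have hint : IntegrableOn f (uIcc a b) :=
    (hf.mono_measure (Measure.restrict_mono hab le_rfl)).integrable one_le_two
  exact hint.intervalIntegrable

/-- The closure of `S` differs from `S` by a null set, and near each of its points it is a
nondegenerate compact interval. This makes one-sided derivatives on the closure unique and lets
almost everywhere statements pass between `S` and its closure. -/
structure IsRegular (S : Set ℝ) : Prop where
  ae_eq_closure : S =ᵐ[volume] closure S
  exists_Icc : ∀ x ∈ closure S, ∃ a b : ℝ, a < b ∧ x ∈ Icc a b ∧ Icc a b ⊆ closure S ∧
    Icc a b ∈ 𝓝[closure S] x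

/-- `u` is of class `H²` on the closure of `S`, with first derivative `p` and second derivative
`q`, and `u` and `q` are square integrable. Carrying the derivatives along as data makes the
boundary values of `u` and `p` accessible without differentiating. -/
structure IsH2On (S : Set ℝ) (u p q : ℝ → ℂ) : Prop where
  isPrimitiveOn : IsPrimitiveOn (closure S) u p
  isPrimitiveOn_deriv : IsPrimitiveOn (closure S) p q
  memLp : MemLp u 2 (volume.restrict S)
  memLp_deriv_deriv : MemLp q 2 (volume.restrict S)

namespace IsRegular

variable {S T : Set ℝ} {u p q : ℝ → ℂ} {x : ℝ}

lemma union (hS : IsRegular S) (hT : IsRegular T) (h : Disjoint (closure S) (closure T)) :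
    IsRegular (S ∪ T) := by
  have nhdsWithin_union_eq : ∀ {A B : Set ℝ} {x : ℝ}, IsClosed B → Disjoint A B → x ∈ A →
      𝓝[A ∪ B] x = 𝓝[A] x := fun {_ B x} hB hAB hx => by
    have hxB : 𝓝[B] x = ⊥ := notMem_closure_iff_nhdsWithin_eq_bot.1
      (by rw [hB.closure_eq]; exact disjoint_left.1 hAB hx)
    rw [nhdsWithin_union, hxB, sup_bot_eq]
  refine ⟨by rw [closure_union]; exact hS.1.union hT.1, fun x hx => ?_⟩
  rw [closure_union] at hx ⊢
  rcases hx with hx | hx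
  · obtain ⟨a, b, hab, hxab, hsub, hnhds⟩ := hS.exists_Icc x hx
    exact ⟨a, b, hab, hxab, hsub.trans subset_union_left,
      by rwa [nhdsWithin_union_eq isClosed_closure h hx]⟩
  · obtain ⟨a, b, hab, hxab, hsub, hnhds⟩ := hT.exists_Icc x hx
    exact ⟨a, b, hab, hxab, hsub.trans subset_union_right,
      by rwa [union_comm, nhdsWithin_union_eq isClosed_closure h.symm hx]⟩

lemma uniqueDiffOn (hS : IsRegular S) : UniqueDiffOn ℝ (closure S) := fun x hx => by
  obtain ⟨a, b, hab, hxab, hsub, -⟩ := hS.exists_Icc x hx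
  exact (uniqueDiffOn_Icc hab x hxab).mono hsub

lemma continuousOn (hS : IsRegular S) (hu : IsPrimitiveOn (closure S) u p) :
    ContinuousOn u (closure S) := fun x hx => by
  obtain ⟨a, b, hab, hxab, hsub, hnhds⟩ := hS.exists_Icc x hx
  rw [← uIcc_of_le hab.le] at hxab hsub hnhds
  exact (hu.continuousOn_uIcc hsub x hxab).mono_of_mem_nhdsWithin hnhds

lemma ae_hasDerivAt (hS : IsRegular S) (hu : IsPrimitiveOn (closure S) u p) :
    ∀ᵐ x ∂volume.restrict S, HasDerivAt u (p x) x := by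
  rw [Measure.restrict_congr_set hS.ae_eq_closure,
    ae_restrict_iff' isClosed_closure.measurableSet, ae_iff]
  set bad := {x | ¬(x ∈ closure S → HasDerivAt u (p x) x)}
  have hbad_subset : bad ⊆ closure S := fun x hx => (Classical.not_imp.1 hx).1
  refine measure_null_of_locally_null _ fun x hx => ?_
  obtain ⟨a, b, hab, -, hsub, hnhds⟩ := hS.exists_Icc x (hbad_subset hx)
  rw [← uIcc_of_le hab.le] at hsub hnhds
  refine ⟨bad ∩ uIcc a b,
    inter_mem self_mem_nhdsWithin (nhdsWithin_mono x hbad_subset hnhds),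
    measure_mono_null ?_ (ae_iff.1 (hu.ae_hasDerivAt hsub))⟩
  rintro y ⟨hy, hyab⟩ hderiv
  exact hy fun _ => hderiv hyab

end IsRegular

lemma isRegular_Ioi (a : ℝ) : IsRegular (Ioi a) where
  ae_eq_closure := by rw [closure_Ioi]; exact Ioi_ae_eq_Ici
  exists_Icc x hx := by
    rw [closure_Ioi] at hx ⊢
    have hx : a ≤ x := hx
    refine ⟨a, x + 1, by linarith, ⟨hx, by linarith⟩, Icc_subset_Ici_self, ?_⟩
    exact mem_nhdsWithin.2 ⟨Iio (x + 1), isOpen_Iio, by simp, fun y hy => ⟨hy.2, hy.1.le⟩⟩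

lemma isRegular_Iio (a : ℝ) : IsRegular (Iio a) where
  ae_eq_closure := by rw [closure_Iio]; exact Iio_ae_eq_Iic
  exists_Icc x hx := by
    rw [closure_Iio] at hx ⊢
    have hx : x ≤ a := hx
    refine ⟨x - 1, a, by linarith, ⟨by linarith, hx⟩, Icc_subset_Iic_self, ?_⟩
    exact mem_nhdsWithin.2 ⟨Ioi (x - 1), isOpen_Ioi, by simp, fun y hy => ⟨hy.1.le, hy.2⟩⟩

namespace IsH2On

variable {S T : Set ℝ} {u p q v r s : ℝ → ℂ}

lemma mono (h : IsH2On S u p q) (hTS : T ⊆ S) : IsH2On T u p q :=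
  ⟨h.1.mono (closure_mono hTS), h.2.mono (closure_mono hTS),
    h.3.mono_measure (Measure.restrict_mono hTS le_rfl),
    h.4.mono_measure (Measure.restrict_mono hTS le_rfl)⟩

lemma congr_deriv_deriv (h : IsH2On S u p q) (hS : S =ᵐ[volume] closure S)
    (hqr : r =ᵐ[volume.restrict S] q) : IsH2On S u p r :=
  ⟨h.1, h.2.congr_ae (eqOn_refl _ _) (by rwa [← Measure.restrict_congr_set hS]), h.3,
    h.4.ae_eq hqr.symm⟩

lemma add (h : IsH2On S u p q) (k : IsH2On S v r s) : IsH2On S (u + v) (p + r) (q + s) :=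
  ⟨h.1.add k.1, h.2.add k.2, h.3.add k.3, h.4.add k.4⟩

lemma const_smul (c : ℂ) (h : IsH2On S u p q) : IsH2On S (c • u) (c • p) (c • q) :=
  ⟨h.1.clm_comp (c • ContinuousLinearMap.id ℝ ℂ), h.2.clm_comp (c • ContinuousLinearMap.id ℝ ℂ),
    h.3.const_smul c, h.4.const_smul c⟩

lemma comp_neg (h : IsH2On S u p q) :
    IsH2On (Neg.neg ⁻¹' S) (fun x => u (-x)) (fun x => -p (-x)) fun x => q (-x) := by
  have hclosure : closure (Neg.neg ⁻¹' S) = Neg.neg ⁻¹' closure S :=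
    ((Homeomorph.neg ℝ).preimage_closure S).symm
  have hmp : MeasurePreserving Neg.neg (volume.restrict (Neg.neg ⁻¹' S)) (volume.restrict S) :=
    (Measure.measurePreserving_neg volume).restrict_preimage_emb
      (MeasurableEquiv.neg ℝ).measurableEmbedding S
  refine ⟨?_, ?_, h.3.comp_measurePreserving hmp, h.4.comp_measurePreserving hmp⟩
  · rw [hclosure]
    exact h.1.comp_neg
  · rw [hclosure]
    simpa only [neg_apply, ContinuousLinearMap.id_apply, neg_neg] using
      h.2.comp_neg.clm_comp (-ContinuousLinearMap.id ℝ ℂ)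

lemma piecewise {A : Set ℝ} [DecidablePred (· ∈ A)] (hA : MeasurableSet A)
    (hSA : closure S ⊆ A) (hTA : Disjoint (closure T) A) (h : IsH2On S u p q)
    (k : IsH2On T v r s) :
    IsH2On (S ∪ T) (A.piecewise u v) (A.piecewise p r) (A.piecewise q s) := by
  have memLp_piecewise : ∀ {φ χ : ℝ → ℂ}, MemLp φ 2 (volume.restrict S) →
      MemLp χ 2 (volume.restrict T) →
      MemLp (A.piecewise φ χ) 2 (volume.restrict (S ∪ T)) := by
    intro φ χ hφ hχ
    refine MemLp.piecewise hA (hφ.mono_measure ?_) (hχ.mono_measure ?_)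
    · rw [Measure.restrict_restrict hA]
      exact Measure.restrict_mono (fun x hx => hx.2.resolve_right fun hT =>
        disjoint_left.1 hTA (subset_closure hT) hx.1) le_rfl
    · rw [Measure.restrict_restrict hA.compl]
      exact Measure.restrict_mono (fun x hx => hx.2.resolve_left fun hS =>
        hx.1 (hSA (subset_closure hS))) le_rfl
  refine ⟨?_, ?_, memLp_piecewise h.3 k.3, memLp_piecewise h.4 k.4⟩ <;> rw [closure_union]
  · exact h.1.piecewise isClosed_closure isClosed_closure hSA hTA k.1
  · exact h.2.piecewise isClosed_closure isClosed_closure hSA hTA k.2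

lemma hasDerivWithinAt (hS : IsRegular S) (h : IsH2On S u p q) {x : ℝ} (hx : x ∈ closure S) :
    HasDerivWithinAt u (p x) (closure S) x := by
  obtain ⟨a, b, -, hxab, hsub, hnhds⟩ := hS.exists_Icc x hx
  have hderiv := h.1.hasDerivWithinAt_Icc hsub hxab ((hS.continuousOn h.2).mono hsub)
  exact hderiv.mono_of_mem_nhdsWithin hnhds

variable {Ω : TopologicalSpace.Opens ℝ}

lemma eqOn_d1 (hΩ : IsRegular Ω) (h : IsH2On Ω u p q) : EqOn (d1 Ω u) p (closure Ω) :=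
  fun x hx => (h.hasDerivWithinAt hΩ hx).derivWithin (hΩ.uniqueDiffOn x hx)

lemma d2_ae_eq (hΩ : IsRegular Ω) (h : IsH2On Ω u p q) :
    d2 Ω u =ᵐ[volume.restrict (Ω : Set ℝ)] q := by
  filter_upwards [hΩ.ae_hasDerivAt h.2, ae_restrict_mem Ω.isOpen.measurableSet] with x hp hx
  have hx' := subset_closure hx
  rw [d2, d1, derivWithin_congr (h.eqOn_d1 hΩ) (h.eqOn_d1 hΩ hx')]
  exact hp.hasDerivWithinAt.derivWithin (hΩ.uniqueDiffOn x hx')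

lemma isAC2 (hΩ : IsRegular Ω) (h : IsH2On Ω u p q) : IsAC2 Ω u where
  ac _ _ hab := h.1.absolutelyContinuousOnInterval hab
  diff _ hx := (h.hasDerivWithinAt hΩ hx).differentiableWithinAt
  ac_d1 _ _ hab := ac_congr ((h.eqOn_d1 hΩ).mono hab) (h.2.absolutelyContinuousOnInterval hab)
  memLp_d2 := h.4.ae_eq (h.d2_ae_eq hΩ).symm

lemma of_isAC2 (hΩ : IsRegular Ω) (hu : IsAC2 Ω u)
    (hmem : MemLp u 2 (volume.restrict (Ω : Set ℝ))) : IsH2On Ω u (d1 Ω u) (d2 Ω u) := by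
  refine ⟨.of_ae_hasDerivAt hu.ac
      (fun a b hab => (hu.ac_d1 a b hab).continuousOn.intervalIntegrable) fun a b hab => ?_,
    .of_ae_hasDerivAt hu.ac_d1
      (fun a b hab => intervalIntegrable_of_memLp hΩ.ae_eq_closure hu.memLp_d2 hab)
      fun a b hab => ?_, hmem, hu.memLp_d2⟩
  · filter_upwards [ae_uIcc_mem_nhds a b] with x hnhds hx
    exact (hu.diff x (hab hx)).hasDerivWithinAt.hasDerivAt (mem_of_superset (hnhds hx) hab)
  · filter_upwards [ae_uIcc_mem_nhds a b,
      (hu.ac_d1 a b hab).boundedVariationOn.ae_differentiableAt_of_mem_uIcc] with x hnhds hdiff hx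
    have hd2 : d2 Ω u x = deriv (d1 Ω u) x :=
      derivWithin_of_mem_nhds (mem_of_superset (hnhds hx) hab)
    exact hd2 ▸ (hdiff hx).hasDerivAt

end IsH2On

lemma exists_ultrafilter_tendsto_zero {F : ℝ → ℝ} {a : ℝ} (hF : IntegrableOn F (Ioi a))
    (hF0 : ∀ x, 0 ≤ F x) : ∃ U : Ultrafilter ℝ, (U : Filter ℝ) ≤ atTop ∧ Tendsto F U (𝓝 0) := by
  rw [← mapClusterPt_iff_ultrafilter, Metric.nhds_basis_ball.mapClusterPt_iff_frequently]
  intro ε hε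
  by_contra hnot
  obtain ⟨c, hc⟩ := eventually_atTop.1 (not_frequently.1 hnot)
  have hle : ∀ x, c ≤ x → ε ≤ F x := fun x hx => by
    simpa [abs_of_nonneg (hF0 x)] using hc x hx
  have hconst : IntegrableOn (fun _ : ℝ => ε) (Ioi (max a c)) := by
    refine (hF.mono_set (Ioi_subset_Ioi (le_max_left a c))).mono' (by fun_prop) ?_
    filter_upwards [ae_restrict_mem measurableSet_Ioi] with x hx
    rw [Real.norm_of_nonneg hε.le]
    exact hle x ((le_max_right a c).trans hx.le)
  simp [integrableOn_const_iff, hε.ne'] at hconst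

namespace IsH2On

variable {S : Set ℝ} {a : ℝ} {u p q v r s : ℝ → ℂ}

lemma star (h : IsH2On S u p q) : IsH2On S (star u) (star p) (star q) :=
  ⟨h.1.clm_comp Complex.conjCLE.toContinuousLinearMap,
    h.2.clm_comp Complex.conjCLE.toContinuousLinearMap, h.3.star, h.4.star⟩

lemma norm_deriv_sub_le (h : IsH2On (Ioi a) u p q) {x t : ℝ} (hx : a ≤ x) (ht : x ≤ t) :
    ‖p t - p x‖ ≤ (t - x) + ∫ y in Ioi a, ‖q y‖ ^ 2 := by
  have hq_sq : IntegrableOn (fun y => ‖q y‖ ^ 2) (Ioi a) := h.4.integrable_norm_pow two_ne_zero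
  have hIcc : uIcc x t ⊆ closure (Ioi a) := by
    rw [closure_Ioi, uIcc_of_le ht]
    exact fun y hy => hx.trans hy.1
  have hIoc : Ioc x t ⊆ Ioi a := fun y hy => hx.trans_lt hy.1
  have hone : Integrable (fun _ => (1 : ℝ)) (volume.restrict (Ioc x t)) := integrable_const 1
  have hq_sq_Ioc : Integrable (fun y => ‖q y‖ ^ 2) (volume.restrict (Ioc x t)) :=
    hq_sq.mono_set hIoc
  calc ‖p t - p x‖ = ‖∫ y in x..t, q y‖ := by rw [h.2.2 x t hIcc]
    _ ≤ ∫ y in Ioc x t, ‖q y‖ := by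
      rw [intervalIntegral.integral_of_le ht]
      exact norm_integral_le_integral_norm _
    _ ≤ ∫ y in Ioc x t, (1 + ‖q y‖ ^ 2) :=
      integral_mono (h.2.1 x t hIcc).1.norm (hone.add hq_sq_Ioc)
        fun y => by nlinarith [sq_nonneg (‖q y‖ - 1), sq_nonneg ‖q y‖]
    _ = (t - x) + ∫ y in Ioc x t, ‖q y‖ ^ 2 := by
      rw [integral_add hone hq_sq_Ioc]
      simp [ht]
    _ ≤ (t - x) + ∫ y in Ioi a, ‖q y‖ ^ 2 :=
      add_le_add_right (setIntegral_mono_set hq_sq (ae_of_all _ fun _ => by positivity)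
        hIoc.eventuallyLE) _

lemma exists_norm_deriv_le (h : IsH2On (Ioi a) u p q) :
    ∃ C, ∀ x, a ≤ x → ‖p x‖ ≤ ‖u x‖ + ‖u (x + 1)‖ + C := by
  refine ⟨1 + ∫ x in Ioi a, ‖q x‖ ^ 2, fun x hx => ?_⟩
  have hx1 : x ≤ x + 1 := by linarith
  have hIcc : uIcc x (x + 1) ⊆ closure (Ioi a) := by
    rw [closure_Ioi, uIcc_of_le hx1]
    exact fun y hy => hx.trans hy.1
  have hint : ∫ t in x..x + 1, (p t - p x) = u (x + 1) - u x - p x := by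
    rw [intervalIntegral.integral_sub (h.1.1 _ _ hIcc) intervalIntegrable_const, h.1.2 _ _ hIcc]
    simp
  have taylor_le : ‖u (x + 1) - u x - p x‖ ≤ 1 + ∫ x in Ioi a, ‖q x‖ ^ 2 := by
    rw [← hint]
    refine (intervalIntegral.norm_integral_le_of_norm_le_const fun t ht => ?_).trans_eq
      (by rw [add_sub_cancel_left, abs_one, mul_one])
    rw [uIoc_of_le hx1] at ht
    exact (h.norm_deriv_sub_le hx ht.1.le).trans (by gcongr; linarith [ht.2])
  calc ‖p x‖ = ‖u (x + 1) - u x - (u (x + 1) - u x - p x)‖ := by rw [sub_sub_cancel]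
    _ ≤ ‖u (x + 1)‖ + ‖u x‖ + ‖u (x + 1) - u x - p x‖ :=
      (norm_sub_le _ _).trans (add_le_add_left (norm_sub_le _ _) _)
    _ ≤ _ := by linarith

lemma integrableOn_sq_add_sq_shift (h : IsH2On (Ioi a) u p q) :
    IntegrableOn (fun x => ‖u x‖ ^ 2 + ‖u (x + 1)‖ ^ 2) (Ioi a) := by
  have hu : IntegrableOn (fun x => ‖u x‖ ^ 2) (Ioi a) := h.3.integrable_norm_pow two_ne_zero
  have hshift := ((measurePreserving_add_right volume (1 : ℝ)).integrableOn_comp_preimage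
    (measurableEmbedding_addRight 1)).2 hu
  exact hu.add (hshift.mono_set fun x (hx : a < x) => (by linarith : a < x + 1))

/-- Along a suitable ultrafilter `u`, `v` and their translates by `1` tend to `0` while `p` and `r`
stay bounded. -/
lemma eq_zero_of_tendsto_wronskian (h : IsH2On (Ioi a) u p q) (k : IsH2On (Ioi a) v r s) {l : ℂ}
    (hl : Tendsto (fun b => u b * r b - p b * v b) atTop (𝓝 l)) : l = 0 := by
  obtain ⟨U, hU, hF⟩ := exists_ultrafilter_tendsto_zero
    (h.integrableOn_sq_add_sq_shift.add k.integrableOn_sq_add_sq_shift)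
    fun x => by simp only [Pi.add_apply]; positivity
  have tendsto_zero : ∀ w : ℝ → ℂ,
      (∀ x, ‖w x‖ ^ 2 ≤ ‖u x‖ ^ 2 + ‖u (x + 1)‖ ^ 2 + (‖v x‖ ^ 2 + ‖v (x + 1)‖ ^ 2)) →
      Tendsto (fun x => ‖w x‖) U (𝓝 0) := by
    intro w hw
    have hsq := squeeze_zero (fun x => sq_nonneg ‖w x‖) hw hF
    simpa using hsq.sqrt
  have hu := tendsto_zero u fun x => by nlinarith [sq_nonneg ‖u (x + 1)‖, sq_nonneg ‖v x‖]
  have hu₁ := tendsto_zero (fun x => u (x + 1)) fun x => by nlinarith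
  have hv := tendsto_zero v fun x => by nlinarith
  have hv₁ := tendsto_zero (fun x => v (x + 1)) fun x => by nlinarith
  obtain ⟨C, hC⟩ := h.exists_norm_deriv_le
  obtain ⟨D, hD⟩ := k.exists_norm_deriv_le
  have hbound : Tendsto (fun x => ‖u x‖ * (‖v x‖ + ‖v (x + 1)‖ + D) +
      (‖u x‖ + ‖u (x + 1)‖ + C) * ‖v x‖) U (𝓝 0) := by
    simpa using (hu.mul ((hv.add hv₁).add_const D)).add (((hu.add hu₁).add_const C).mul hv)
  refine tendsto_nhds_unique (hl.mono_left hU) (squeeze_zero_norm' ?_ hbound)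
  filter_upwards [hU (eventually_ge_atTop a)] with x hx
  refine (norm_sub_le _ _).trans ?_
  rw [norm_mul, norm_mul]
  gcongr
  exacts [hD x hx, hC x hx]

lemma integrableOn_mul_sub_mul (h : IsH2On S u p q) (k : IsH2On S v r s) :
    IntegrableOn (fun x => u x * s x - q x * v x) S :=
  (h.3.integrable_mul k.4).sub (h.4.integrable_mul k.3)

lemma integral_Ioi_mul_sub_mul (h : IsH2On (Ioi a) u p q) (k : IsH2On (Ioi a) v r s) :
    ∫ x in Ioi a, (u x * s x - q x * v x) = p a * v a - u a * r a := by
  have hlim : Tendsto (fun b => u b * r b - p b * v b) atTop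
      (𝓝 ((u a * r a - p a * v a) + ∫ x in Ioi a, (u x * s x - q x * v x))) := by
    refine (tendsto_const_nhds.add (intervalIntegral_tendsto_integral_Ioi a
      (h.integrableOn_mul_sub_mul k) tendsto_id)).congr' ?_
    filter_upwards [eventually_ge_atTop a] with b hb
    have hab : uIcc a b ⊆ closure (Ioi a) := by
      rw [closure_Ioi, uIcc_of_le hb]; exact Icc_subset_Ici_self
    have hW := ((h.1.mul k.2).sub (h.2.mul k.1)).eq_add_integral hab
    simp only [Pi.sub_apply, Pi.mul_apply, Pi.add_apply] at hW
    rw [hW]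
    exact congrArg _ (intervalIntegral.integral_congr fun x _ => by ring)
  linear_combination h.eq_zero_of_tendsto_wronskian k hlim

lemma integral_Iio_mul_sub_mul (h : IsH2On (Iio a) u p q) (k : IsH2On (Iio a) v r s) :
    ∫ x in Iio a, (u x * s x - q x * v x) = u a * r a - p a * v a := by
  have hpre : Neg.neg ⁻¹' Iio a = Ioi (-a) := by ext x; simp
  have h' := h.comp_neg
  have k' := k.comp_neg
  rw [hpre] at h' k'
  have hgreen := h'.integral_Ioi_mul_sub_mul k'
  rw [integral_comp_neg_Ioi (f := fun x => u x * s x - q x * v x)] at hgreen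
  simp only [neg_neg] at hgreen
  rw [← integral_Iic_eq_integral_Iio, hgreen]
  ring

end IsH2On

/-! ### Test functions and weak derivatives -/

/-- A real-valued test function on `S`. -/
structure IsTest (S : Set ℝ) (φ : ℝ → ℝ) : Prop where
  contDiff : ContDiff ℝ ∞ φ
  hasCompactSupport : HasCompactSupport φ
  tsupport_subset : tsupport φ ⊆ S

namespace IsTest

variable {S T : Set ℝ} {φ χ : ℝ → ℝ}

lemma mono (h : IsTest S φ) (hST : S ⊆ T) : IsTest T φ := ⟨h.1, h.2, h.3.trans hST⟩

lemma deriv (h : IsTest S φ) : IsTest S (deriv φ) :=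
  ⟨ContDiff.deriv' h.1, h.2.deriv, tsupport_deriv_subset.trans h.3⟩

lemma hasDerivAt (h : IsTest S φ) (x : ℝ) : HasDerivAt φ (_root_.deriv φ x) x :=
  (h.1.differentiable (by simp)).differentiableAt.hasDerivAt

lemma sub_const_mul (h : IsTest S φ) (k : IsTest S χ) (c : ℝ) :
    IsTest S (fun x => φ x - c * χ x) :=
  ⟨h.1.sub (contDiff_const.mul k.1), h.2.sub (k.2.mul_left (f := fun _ => c)),
    (tsupport_sub φ _).trans (union_subset h.3
      ((tsupport_mul_subset_right (f := fun _ => c)).trans k.3))⟩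

lemma integrable (h : IsTest S φ) : Integrable φ :=
  h.1.continuous.integrable_of_hasCompactSupport h.2

lemma integrable_smul {w : ℝ → ℂ} (h : IsTest S φ) (hw : LocallyIntegrableOn w S) :
    Integrable (fun x => φ x • w x) :=
  (integrableOn_iff_integrable_of_support_subset
    ((Function.support_smul_subset_left φ w).trans (subset_tsupport φ))).1
    ((hw.integrableOn_compact_subset h.3 h.2).continuousOn_smul h.1.continuous.continuousOn h.2)

lemma integral_smul_indicator (h : IsTest S φ) (q : ℝ → ℂ) :
    ∫ x, φ x • S.indicator q x = ∫ x, φ x • q x := by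
  congr 1 with x
  by_cases hx : x ∈ S
  · rw [indicator_of_mem hx]
  · rw [image_eq_zero_of_notMem_tsupport (mt (@h.3 x) hx), zero_smul, zero_smul]

lemma exists_tsupport_subset_Ioo [S.OrdConnected] (hS : IsOpen S) (hne : S.Nonempty)
    (h : IsTest S φ) : ∃ c d, c ≤ d ∧ Icc c d ⊆ S ∧ tsupport φ ⊆ Ioo c d := by
  obtain ⟨s, hs⟩ := hne
  have hK : IsCompact (insert s (tsupport φ)) := h.2.isCompact.insert s
  have hKS : insert s (tsupport φ) ⊆ S := insert_subset hs h.3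
  obtain ⟨x, hx, hx_le⟩ := hK.exists_isLeast (insert_nonempty _ _)
  obtain ⟨y, hy, hy_ge⟩ := hK.exists_isGreatest (insert_nonempty _ _)
  obtain ⟨c, hcS, hcx : c < x⟩ := Filter.nonempty_of_mem (inter_mem
    (mem_nhdsWithin_of_mem_nhds (hS.mem_nhds (hKS hx))) (self_mem_nhdsWithin (s := Iio x)))
  obtain ⟨d, hdS, hyd : y < d⟩ := Filter.nonempty_of_mem (inter_mem
    (mem_nhdsWithin_of_mem_nhds (hS.mem_nhds (hKS hy))) (self_mem_nhdsWithin (s := Ioi y)))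
  exact ⟨c, d, hcx.le.trans ((hx_le hy).trans hyd.le), Set.OrdConnected.out ‹_› hcS hdS,
    fun z hz => ⟨hcx.trans_le (hx_le (mem_insert_of_mem s hz)),
      (hy_ge (mem_insert_of_mem s hz)).trans_lt hyd⟩⟩

lemma integral_deriv_smul [S.OrdConnected] (hS : IsOpen S) (hne : S.Nonempty) (h : IsTest S φ)
    {F F' : ℝ → ℂ} (hF : IsPrimitiveOn S F F') :
    ∫ x, _root_.deriv φ x • F x = -∫ x, φ x • F' x := by
  obtain ⟨c, d, hcd, hcdS, hsupp⟩ := h.exists_tsupport_subset_Ioo hS hne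
  have hu : uIcc c d ⊆ S := by rwa [uIcc_of_le hcd]
  have hφ : IsPrimitiveOn S (fun x => (φ x : ℂ)) (fun x => ((_root_.deriv φ x : ℝ) : ℂ)) :=
    .of_hasDerivAt (fun x => (h.hasDerivAt x).ofReal_comp)
      (Complex.continuous_ofReal.comp h.deriv.1.continuous)
  have eq_zero : ∀ x, x ∉ Ioo c d → φ x = 0 := fun x hx => image_eq_zero_of_notMem_tsupport
    (mt (@hsupp x) hx)
  have integral_eq : ∀ (χ : ℝ → ℝ) (w : ℝ → ℂ), tsupport χ ⊆ Ioo c d →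
      ∫ x in c..d, (χ x : ℂ) * w x = ∫ x, χ x • w x := fun χ w hχ => by
    simp only [← Complex.real_smul]
    exact intervalIntegral.integral_eq_integral_of_support_subset
      ((Function.support_smul_subset_left χ w).trans
        ((subset_tsupport χ).trans (hχ.trans Ioo_subset_Ioc_self)))
  have hparts := (hφ.mul hF).2 c d hu
  simp only [Pi.mul_apply, Pi.add_apply, eq_zero c (by simp), eq_zero d (by simp)] at hparts
  rw [intervalIntegral.integral_add ((hφ.1 c d hu).mul_continuousOn (hF.continuousOn_uIcc hu))
    ((hF.1 c d hu).continuousOn_mul (hφ.continuousOn_uIcc hu)),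
    integral_eq _ _ (tsupport_deriv_subset.trans hsupp), integral_eq _ _ hsupp] at hparts
  simp only [Complex.ofReal_zero, zero_mul, sub_zero] at hparts
  exact eq_neg_of_add_eq_zero_left hparts

lemma exists_deriv_eq [S.OrdConnected] (hS : IsOpen S) (hne : S.Nonempty) (h : IsTest S φ)
    (h0 : ∫ x, φ x = 0) : ∃ η, IsTest S η ∧ _root_.deriv η = φ := by
  obtain ⟨c, d, -, hcdS, hsupp⟩ := h.exists_tsupport_subset_Ioo hS hne
  set η : ℝ → ℝ := fun x => ∫ t in c..x, φ t with hη
  have hderiv : ∀ x, HasDerivAt η (φ x) x := fun x =>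
    (h.1.continuous.integral_hasStrictDerivAt c x).hasDerivAt
  have hderiv_eq : _root_.deriv η = φ := funext fun x => (hderiv x).deriv
  have eq_zero : ∀ x, x ∉ Ioo c d → φ x = 0 := fun x hx => image_eq_zero_of_notMem_tsupport
    (mt (@hsupp x) hx)
  have eq_zero_of_lt : ∀ x < c, η x = 0 := fun x hx =>
    (intervalIntegral.integral_congr fun t ht => eq_zero t fun ht' => by
      rw [uIcc_of_ge hx.le] at ht
      exact ht'.1.not_ge ht.2).trans intervalIntegral.integral_zero
  have eq_zero_of_gt : ∀ x > d, η x = 0 := fun x hx => by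
    rw [hη, ← h0]
    refine intervalIntegral.integral_eq_integral_of_support_subset fun t ht => ?_
    have ht' := hsupp (subset_tsupport φ ht)
    exact ⟨ht'.1, (ht'.2.trans hx).le⟩
  have hη_supp : Function.support η ⊆ Icc c d := fun x hx =>
    ⟨not_lt.1 fun hlt => hx (eq_zero_of_lt x hlt), not_lt.1 fun hlt => hx (eq_zero_of_gt x hlt)⟩
  refine ⟨η, ⟨?_, .of_support_subset_isCompact isCompact_Icc hη_supp,
    (closure_minimal hη_supp isClosed_Icc).trans hcdS⟩, hderiv_eq⟩
  rw [contDiff_infty_iff_deriv, hderiv_eq]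
  exact ⟨fun x => (hderiv x).differentiableAt, h.1⟩

lemma exists_integral_eq_one (hS : IsOpen S) (hne : S.Nonempty) :
    ∃ φ, IsTest S φ ∧ ∫ x, φ x = 1 := by
  obtain ⟨s, hs⟩ := hne
  obtain ⟨ε, hε, hball⟩ := Metric.nhds_basis_closedBall.mem_iff.1 (hS.mem_nhds hs)
  let f : ContDiffBump s := ⟨ε / 2, ε, half_pos hε, half_lt_self hε⟩
  refine ⟨f.normed volume, ⟨f.contDiff_normed, f.hasCompactSupport_normed, ?_⟩, f.integral_normed⟩
  rwa [f.tsupport_normed_eq]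

lemma exists_deriv_eq_sub_const_mul [S.OrdConnected] (hS : IsOpen S) (hne : S.Nonempty)
    (h : IsTest S φ) (k : IsTest S χ) (hχ : ∫ x, χ x = 1) :
    ∃ η, IsTest S η ∧ _root_.deriv η = fun x => φ x - (∫ y, φ y) * χ x :=
  (h.sub_const_mul k _).exists_deriv_eq hS hne (by
    rw [integral_sub h.integrable (k.integrable.const_mul _), integral_const_mul, hχ]
    ring)

end IsTest

section WeakDerivatives

variable {S : Set ℝ} {w u q : ℝ → ℂ}

lemma ae_eq_const_of_integral_deriv_smul_eq_zero [S.OrdConnected]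
    (hS : IsOpen S) (hne : S.Nonempty) (hw : LocallyIntegrableOn w S)
    (h : ∀ φ, IsTest S φ → ∫ x, deriv φ x • w x = 0) :
    ∃ c, ∀ᵐ x, x ∈ S → w x = c := by
  obtain ⟨χ, hχ, hχ_one⟩ := IsTest.exists_integral_eq_one hS hne
  refine ⟨∫ x, χ x • w x, ?_⟩
  have hw_sub : LocallyIntegrableOn (fun x => w x - ∫ x, χ x • w x) S :=
    hw.sub ((locallyIntegrable_const _).locallyIntegrableOn _)
  have ae_eq_zero := hS.ae_eq_zero_of_integral_contDiff_smul_eq_zero hw_sub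
      fun φ hφ_smooth hφ_compact hφ_supp => by
    have hφ : IsTest S φ := ⟨hφ_smooth, hφ_compact, hφ_supp⟩
    obtain ⟨η, hη, hη_deriv⟩ := hφ.exists_deriv_eq_sub_const_mul hS hne hχ hχ_one
    have hη_zero := h η hη
    simp only [hη_deriv, sub_smul, mul_smul] at hη_zero
    rw [integral_sub (hφ.integrable_smul hw) ((hχ.integrable_smul hw).fun_smul _),
      integral_smul] at hη_zero
    simp only [smul_sub]
    rw [integral_sub (hφ.integrable_smul hw) (hφ.integrable.smul_const _),
      integral_smul_const, hη_zero]
  filter_upwards [ae_eq_zero] with x hx hxS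
  exact sub_eq_zero.1 (hx hxS)

lemma isPrimitiveOn_const (S : Set ℝ) (c : ℂ) : IsPrimitiveOn S (fun _ => c) 0 :=
  .of_hasDerivAt (fun x => hasDerivAt_const x c) continuous_const

lemma isPrimitiveOn_const_mul_ofReal (S : Set ℝ) (c : ℂ) :
    IsPrimitiveOn S (fun x => c * x) fun _ => c :=
  .of_hasDerivAt (fun x => by simpa using (Complex.ofRealCLM.hasDerivAt (x := x)).const_mul c)
    continuous_const

lemma ae_eq_affine_of_integral_deriv_deriv_smul_eq_zero [S.OrdConnected]
    (hS : IsOpen S) (hne : S.Nonempty) (hw : LocallyIntegrableOn w S)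
    (h : ∀ φ, IsTest S φ → ∫ x, deriv (deriv φ) x • w x = 0) :
    ∃ c d : ℂ, ∀ᵐ x, x ∈ S → w x = c + d * x := by
  obtain ⟨χ, hχ, hχ_one⟩ := IsTest.exists_integral_eq_one hS hne
  set d : ℂ := -∫ x, deriv χ x • w x with hd
  have hlin : LocallyIntegrableOn (fun x : ℝ => d * x) S :=
    (Continuous.locallyIntegrable (by fun_prop)).locallyIntegrableOn _
  obtain ⟨c, hc⟩ := ae_eq_const_of_integral_deriv_smul_eq_zero hS hne (hw.sub hlin)
      fun φ hφ => by
    obtain ⟨η, hη, hη_deriv⟩ := hφ.exists_deriv_eq_sub_const_mul hS hne hχ hχ_one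
    have hη_deriv₂ : deriv (deriv η) = fun x => deriv φ x - (∫ y, φ y) * deriv χ x := by
      rw [hη_deriv]
      exact funext fun x => ((hφ.hasDerivAt x).sub ((hχ.hasDerivAt x).const_mul _)).deriv
    have hη_zero := h η hη
    simp only [hη_deriv₂, sub_smul, mul_smul] at hη_zero
    rw [integral_sub (hφ.deriv.integrable_smul hw) ((hχ.deriv.integrable_smul hw).fun_smul _),
      integral_smul] at hη_zero
    simp only [Pi.sub_apply, smul_sub]
    rw [integral_sub (hφ.deriv.integrable_smul hw) (hφ.deriv.integrable_smul hlin),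
      hφ.integral_deriv_smul hS hne (isPrimitiveOn_const_mul_ofReal S d), integral_smul_const,
      sub_neg_eq_add, hd, smul_neg, ← sub_eq_add_neg, hη_zero]
  refine ⟨c, d, ?_⟩
  filter_upwards [hc] with x hx hxS
  exact sub_eq_iff_eq_add.1 (hx hxS)

lemma exists_isPrimitiveOn_isPrimitiveOn (hq : LocallyIntegrable q) :
    ∃ G P : ℝ → ℂ, Continuous G ∧ IsPrimitiveOn univ G P ∧ IsPrimitiveOn univ P q := by
  have hq_int : ∀ a b, IntervalIntegrable q volume a b := fun a b =>
    (hq.integrableOn_isCompact isCompact_uIcc).intervalIntegrable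
  have hP_int := (intervalIntegral.continuous_primitive hq_int 0).intervalIntegrable (μ := volume)
  exact ⟨fun x => ∫ t in 0..x, ∫ s in 0..t, q s, fun x => ∫ t in 0..x, q t,
    intervalIntegral.continuous_primitive hP_int 0,
    isPrimitiveOn_intervalIntegral (mem_univ 0) fun a b _ => hP_int a b,
    isPrimitiveOn_intervalIntegral (mem_univ 0) fun a b _ => hq_int a b⟩

theorem exists_isH2On_of_integral_deriv_deriv_smul_eq [S.OrdConnected] (hS : IsOpen S)
    (hne : S.Nonempty) (hu : MemLp u 2 (volume.restrict S)) (hq : MemLp q 2 (volume.restrict S))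
    (h : ∀ φ, IsTest S φ → ∫ x, deriv (deriv φ) x • u x = ∫ x, φ x • q x) :
    ∃ v p, IsH2On S v p q ∧ u =ᵐ[volume.restrict S] v := by
  have hSc : S =ᵐ[volume] closure S :=
    (closure_ae_eq_of_null_frontier ((Set.OrdConnected.convex ‹_›).addHaar_frontier volume)).symm
  have hqQ : q =ᵐ[volume.restrict S] S.indicator q :=
    (indicator_ae_eq_restrict hS.measurableSet).symm
  obtain ⟨G, P, hG_cont, hG, hP⟩ := exists_isPrimitiveOn_isPrimitiveOn
    (((memLp_indicator_iff_restrict hS.measurableSet).2 hq).locallyIntegrable one_le_two)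
  have hG_loc : LocallyIntegrableOn G S := hG_cont.locallyIntegrable.locallyIntegrableOn S
  have hu_loc : LocallyIntegrableOn u S :=
    locallyIntegrableOn_of_locallyIntegrable_restrict (hu.locallyIntegrable one_le_two)
  obtain ⟨c, d, haffine⟩ := ae_eq_affine_of_integral_deriv_deriv_smul_eq_zero hS hne
      (hu_loc.sub hG_loc) fun φ hφ => by
    simp only [Pi.sub_apply, smul_sub]
    rw [integral_sub (hφ.deriv.deriv.integrable_smul hu_loc)
      (hφ.deriv.deriv.integrable_smul hG_loc), h φ hφ,
      hφ.deriv.integral_deriv_smul hS hne (hG.mono (subset_univ S)),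
      hφ.integral_deriv_smul hS hne (hP.mono (subset_univ S)), neg_neg,
      hφ.integral_smul_indicator, sub_self]
  have huv : u =ᵐ[volume.restrict S] G + ((fun _ => c) + fun x : ℝ => d * x) := by
    refine (ae_restrict_iff' hS.measurableSet).2 ?_
    filter_upwards [haffine] with x hx hxS
    rw [Pi.add_apply, Pi.add_apply, ← hx hxS, Pi.sub_apply, add_sub_cancel]
  have hG_affine := hG.add
    ((isPrimitiveOn_const univ c).add (isPrimitiveOn_const_mul_ofReal univ d))
  have hP_const := hP.add (isPrimitiveOn_const univ d)
  rw [add_zero] at hP_const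
  rw [zero_add] at hG_affine
  exact ⟨_, _, IsH2On.congr_deriv_deriv ⟨hG_affine.mono (subset_univ _),
    hP_const.mono (subset_univ _), hu.ae_eq huv, hq.ae_eq hqQ⟩ hSc hqQ, huv⟩

end WeakDerivatives

section Adjoint

variable {𝕜 E F : Type*} [RCLike 𝕜] [NormedAddCommGroup E] [InnerProductSpace 𝕜 E]
  [NormedAddCommGroup F] [InnerProductSpace 𝕜 F]

lemma adjoint_topologicalClosure (g : Submodule 𝕜 (E × F)) :
    g.topologicalClosure.adjoint = g.adjoint := by
  ext x
  simp only [Submodule.mem_adjoint_iff]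
  refine ⟨fun h a b hab => h a b (g.le_topologicalClosure hab), fun h a b hab => ?_⟩
  have hclosed : IsClosed {z : E × F | inner 𝕜 z.2 x.1 - inner 𝕜 z.1 x.2 = 0} :=
    isClosed_eq (by fun_prop) continuous_const
  exact closure_minimal (s := (g : Set (E × F))) (fun z hz => h z.1 z.2 hz) hclosed hab

variable [CompleteSpace E]

lemma adjoint_adjoint [CompleteSpace F] (g : Submodule 𝕜 (E × F)) :
    g.adjoint.adjoint = g.topologicalClosure := by
  let K : Submodule 𝕜 (WithLp 2 (E × F)) := g.comap (WithLp.linearEquiv 2 𝕜 (E × F)).toLinearMap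
  have mem_orthogonal_iff (w : WithLp 2 (E × F)) : w ∈ Kᗮ ↔ (-w.snd, w.fst) ∈ g.adjoint := by
    simp only [Submodule.mem_orthogonal, Submodule.mem_adjoint_iff, WithLp.prod_inner_apply,
      WithLp.ofLp_fst, WithLp.ofLp_snd, inner_neg_right]
    refine ⟨fun h a b hab => ?_, fun h z hz => ?_⟩
    · rw [← neg_add', neg_eq_zero, add_comm]
      exact h (WithLp.toLp 2 (a, b)) hab
    · linear_combination -h z.fst z.snd hz
  have closure_K : closure (K : Set (WithLp 2 (E × F))) = WithLp.ofLp ⁻¹' closure (g : Set _) :=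
    ((WithLp.homeomorphProd 2 E F).preimage_closure _).symm
  ext ⟨x, y⟩
  calc (x, y) ∈ g.adjoint.adjoint
    _ ↔ WithLp.toLp 2 (x, y) ∈ Kᗮᗮ := by
      simp only [Submodule.mem_orthogonal, Submodule.mem_adjoint_iff, mem_orthogonal_iff,
        WithLp.prod_inner_apply]
      refine ⟨fun h w hw => ?_, fun h a b hab => ?_⟩
      · simpa [add_comm] using h _ _ hw
      · have := h (WithLp.toLp 2 (b, -a)) (by simpa using hab)
        simpa [sub_eq_add_neg] using this
    _ ↔ (x, y) ∈ g.topologicalClosure := by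
      rw [Submodule.orthogonal_orthogonal_eq_closure, ← SetLike.mem_coe,
        Submodule.topologicalClosure_coe, closure_K]
      rfl

variable {T : E →ₗ.[𝕜] F}

lemma adjoint_closure_of_isClosable (hdense : Dense (T.domain : Set E)) (hT : T.IsClosable) :
    T.closure† = T† := by
  refine LinearPMap.eq_of_eq_graph ?_
  rw [LinearPMap.adjoint_graph_eq_graph_adjoint hdense,
    LinearPMap.adjoint_graph_eq_graph_adjoint (hdense.mono T.le_closure.1),
    ← hT.graph_closure_eq_closure_graph, adjoint_topologicalClosure]

lemma graph_closure_eq_adjoint_graph_adjoint [CompleteSpace F] (hdense : Dense (T.domain : Set E))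
    (hT : T.IsClosable) : T.closure.graph = T†.graph.adjoint := by
  rw [LinearPMap.adjoint_graph_eq_graph_adjoint hdense, adjoint_adjoint,
    hT.graph_closure_eq_closure_graph]

end Adjoint

lemma mem_graph_domRestrict_iff {R E F : Type*} [Ring R] [AddCommGroup E] [Module R E]
    [AddCommGroup F] [Module R F] {T : E →ₗ.[R] F} {S : Submodule R E} {x : E} {y : F} :
    (x, y) ∈ (T.domRestrict S).graph ↔ x ∈ S ∧ (x, y) ∈ T.graph := by
  simp only [LinearPMap.mem_graph_iff]
  constructor
  · rintro ⟨z, rfl, rfl⟩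
    exact ⟨z.2.1, ⟨z, z.2.2⟩, rfl, (LinearPMap.domRestrict_apply rfl).symm⟩
  · rintro ⟨hx, z, rfl, rfl⟩
    exact ⟨⟨z, hx, z.2⟩, rfl, LinearPMap.domRestrict_apply rfl⟩

namespace IsTest

variable {Ω : TopologicalSpace.Opens ℝ} {φ : ℝ → ℝ}

lemma contDiff_ofReal (h : IsTest Ω φ) : ContDiff ℝ ∞ fun x => (φ x : ℂ) :=
  Complex.ofRealCLM.contDiff.comp h.contDiff

lemma hasCompactSupport_ofReal (h : IsTest Ω φ) : HasCompactSupport fun x => (φ x : ℂ) :=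
  h.hasCompactSupport.comp_left Complex.ofReal_zero

lemma tsupport_ofReal_subset (h : IsTest Ω φ) : tsupport (fun x => (φ x : ℂ)) ⊆ Ω :=
  (closure_mono (Function.support_comp_subset Complex.ofReal_zero φ)).trans h.tsupport_subset

lemma memLp_ofReal (h : IsTest Ω φ) :
    MemLp (fun x => (φ x : ℂ)) 2 (volume.restrict (Ω : Set ℝ)) :=
  (h.contDiff_ofReal.continuous.memLp_of_hasCompactSupport h.hasCompactSupport_ofReal).restrict _

lemma deriv_ofReal (h : IsTest Ω φ) :
    _root_.deriv (fun x => (φ x : ℂ)) = fun x => ((_root_.deriv φ x : ℝ) : ℂ) :=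
  funext fun x => (h.hasDerivAt x).ofReal_comp.deriv

/-- The vector of `L²(Ω)` represented by the test function `φ`. -/
def toL2 (h : IsTest Ω φ) : L2 Ω := h.memLp_ofReal.toLp _

lemma toL2_mem_testFunctions (h : IsTest Ω φ) : h.toL2 ∈ testFunctions Ω :=
  ⟨_, h.contDiff_ofReal, h.hasCompactSupport_ofReal, h.tsupport_ofReal_subset,
    h.memLp_ofReal.coeFn_toLp⟩

lemma inner_toL2 (h : IsTest Ω φ) (f : L2 Ω) : inner ℂ h.toL2 f = ∫ x, φ x • f x := by
  have eq_zero_off (x : ℝ) (hx : x ∉ Ω) : φ x • f x = 0 := by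
    rw [image_eq_zero_of_notMem_tsupport fun k => hx (h.tsupport_subset k), zero_smul]
  rw [L2.inner_def, ← setIntegral_eq_integral_of_forall_compl_eq_zero eq_zero_off]
  refine integral_congr_ae ?_
  filter_upwards [h.memLp_ofReal.coeFn_toLp] with x hx
  rw [toL2, hx, RCLike.inner_apply, Complex.conj_ofReal, Complex.real_smul, mul_comm]

lemma toL2_mem_graph (h : IsTest Ω φ) :
    (h.toL2, -h.deriv.deriv.toL2) ∈ ((maxOperator Ω).domRestrict (testFunctions Ω)).graph := by
  have hAC := isAC2_of_contDiff h.contDiff_ofReal h.hasCompactSupport_ofReal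
    h.tsupport_ofReal_subset
  have hrep := h.memLp_ofReal.coeFn_toLp
  refine mem_graph_domRestrict_iff.2 ⟨h.toL2_mem_testFunctions, (LinearPMap.mem_graph_iff _).2
    ⟨⟨h.toL2, _, hAC, hrep⟩, rfl, Lp.ext ?_⟩⟩
  refine (negSecondDeriv_ae ⟨h.toL2, _, hAC, hrep⟩ hAC hrep).trans
    (EventuallyEq.trans ?_ (Lp.coeFn_neg _).symm)
  have d1_eqOn (χ : ℝ → ℂ) : EqOn (d1 Ω χ) (_root_.deriv χ) Ω := fun x hx =>
    derivWithin_of_mem_nhds (mem_of_superset (Ω.isOpen.mem_nhds hx) subset_closure)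
  filter_upwards [h.deriv.deriv.memLp_ofReal.coeFn_toLp, ae_restrict_mem Ω.isOpen.measurableSet]
    with x hx hxΩ
  rw [Pi.neg_apply, toL2, hx, d2, d1_congr (d1_eqOn _) hxΩ, d1_eqOn _ hxΩ, h.deriv_ofReal,
    h.deriv.deriv_ofReal]

lemma integral_deriv_deriv_smul_of_mem_adjoint (h : IsTest Ω φ) {f g : L2 Ω}
    (hfg : (f, g) ∈ ((maxOperator Ω).domRestrict (testFunctions Ω)).graph.adjoint) :
    ∫ x, _root_.deriv (_root_.deriv φ) x • f x = ∫ x, φ x • (-g) x := by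
  have := (Submodule.mem_adjoint_iff _ _).1 hfg _ _ h.toL2_mem_graph
  rw [inner_neg_left, h.deriv.deriv.inner_toL2, h.inner_toL2] at this
  have integral_neg_smul : ∫ x, φ x • (-g) x = -∫ x, φ x • g x := by
    rw [← h.inner_toL2, ← h.inner_toL2, inner_neg_right]
  rw [integral_neg_smul]
  linear_combination -this

end IsTest

lemma dense_testFunctions (Ω : TopologicalSpace.Opens ℝ) :
    Dense (testFunctions Ω : Set (L2 Ω)) := by
  rw [Submodule.dense_iff_topologicalClosure_eq_top, Submodule.topologicalClosure_eq_top_iff,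
    Submodule.eq_bot_iff]
  intro f hf
  have hloc : LocallyIntegrableOn f (Ω : Set ℝ) := locallyIntegrableOn_of_locallyIntegrable_restrict
    ((Lp.memLp f).locallyIntegrable one_le_two)
  have hzero := Ω.isOpen.ae_eq_zero_of_integral_contDiff_smul_eq_zero hloc fun φ h1 h2 h3 => by
    have hφ : IsTest Ω φ := ⟨h1, h2, h3⟩
    rw [← hφ.inner_toL2]
    exact (Submodule.mem_orthogonal _ _).1 hf _ hφ.toL2_mem_testFunctions
  exact (Lp.eq_zero_iff_ae_eq_zero).2 ((ae_restrict_iff' Ω.isOpen.measurableSet).2 hzero)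

/-! ### Boundary values -/

open scoped ComplexConjugate

/-- The sesquilinear Wronskian of two pairs `(ψ(p), ψ'(p))` of boundary values. -/
def wronskian (l m : ℂ × ℂ) : ℂ := conj l.1 * m.2 - conj l.2 * m.1

/-- The direction of `robinLine α`. -/
def robinVector (α : OnePoint ℝ) : ℂ × ℂ := α.elim (0, 1) fun a => (1, a)

/-- The line of all pairs `(ψ(p), ψ'(p))` of boundary values that satisfy the boundary condition
with parameter `α`, see `boundaryCondition_iff`. -/
def robinLine (α : OnePoint ℝ) : Submodule ℂ (ℂ × ℂ) := Submodule.span ℂ {robinVector α}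

/-- The exchange of the boundary values of `ψ` at `p` with those of `x ↦ ψ(-x)` at `-p`. -/
def reflect : (ℂ × ℂ) ≃ₗ[ℂ] ℂ × ℂ := (LinearEquiv.refl ℂ ℂ).prodCongr (LinearEquiv.neg ℂ)

section BoundaryLines

variable {α β : OnePoint ℝ} {l m v : ℂ × ℂ}

lemma reflect_apply (l : ℂ × ℂ) : reflect l = (l.1, -l.2) := rfl

lemma reflect_reflect (l : ℂ × ℂ) : reflect (reflect l) = l := by simp [reflect_apply]

lemma wronskian_zero_right (l : ℂ × ℂ) : wronskian l 0 = 0 := by simp [wronskian]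

lemma wronskian_zero_left (l : ℂ × ℂ) : wronskian 0 l = 0 := by simp [wronskian]

lemma wronskian_smul_left (c : ℂ) (l m : ℂ × ℂ) : wronskian (c • l) m = conj c * wronskian l m := by
  simp only [wronskian, Prod.smul_fst, Prod.smul_snd, smul_eq_mul, map_mul]
  ring

lemma eq_zero_of_forall_wronskian_eq_zero (h : ∀ l, wronskian l m = 0) : m = 0 := by
  have h1 := h (0, 1)
  have h2 := h (1, 0)
  simp only [wronskian, map_zero, map_one, zero_mul, one_mul, zero_sub, sub_zero,
    neg_eq_zero] at h1 h2
  exact Prod.ext h1 h2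

lemma mem_robinLine_coe_iff (a : ℝ) : l ∈ robinLine a ↔ l.2 = a * l.1 := by
  rw [robinLine, Submodule.mem_span_singleton]
  constructor
  · rintro ⟨c, rfl⟩
    simp [robinVector, mul_comm]
  · intro h
    exact ⟨l.1, Prod.ext (by simp [robinVector]) (by simp [robinVector, h, mul_comm])⟩

lemma mem_robinLine_infty_iff : l ∈ robinLine OnePoint.infty ↔ l.1 = 0 := by
  rw [robinLine, Submodule.mem_span_singleton]
  constructor
  · rintro ⟨c, rfl⟩
    simp [robinVector]
  · intro h
    exact ⟨l.2, Prod.ext (by simp [robinVector, h]) (by simp [robinVector])⟩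

lemma mem_robinLine_iff_wronskian_robinVector :
    l ∈ robinLine α ↔ wronskian (robinVector α) l = 0 := by
  cases α using OnePoint.rec with
  | infty => simp [mem_robinLine_infty_iff, wronskian, robinVector]
  | coe a => simp [mem_robinLine_coe_iff, wronskian, robinVector, sub_eq_zero]

lemma mem_robinLine_iff_forall_wronskian_eq_zero :
    m ∈ robinLine α ↔ ∀ l ∈ robinLine α, wronskian l m = 0 := by
  rw [mem_robinLine_iff_wronskian_robinVector]
  refine ⟨fun h l hl => ?_, fun h => h _ (Submodule.mem_span_singleton_self _)⟩
  obtain ⟨c, rfl⟩ := Submodule.mem_span_singleton.1 hl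
  rw [wronskian_smul_left, h, mul_zero]

lemma robinLine_eq_span_singleton (hv : v ∈ robinLine α) (hv0 : v ≠ 0) :
    robinLine α = Submodule.span ℂ {v} := by
  obtain ⟨c, rfl⟩ := Submodule.mem_span_singleton.1 hv
  exact (Submodule.span_singleton_smul_eq (left_ne_zero_of_smul hv0).isUnit _).symm

lemma robinLine_injective : Function.Injective robinLine := fun α β h => by
  have hmem : robinVector α ∈ robinLine β := h ▸ Submodule.mem_span_singleton_self _
  cases α using OnePoint.rec <;> cases β using OnePoint.rec <;>
    simp_all [mem_robinLine_infty_iff, mem_robinLine_coe_iff, robinVector]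

lemma mem_robinLine_map_neg_iff : l ∈ robinLine (α.map Neg.neg) ↔ reflect l ∈ robinLine α := by
  cases α using OnePoint.rec with
  | infty => simp [mem_robinLine_infty_iff, reflect_apply]
  | coe a => simp [mem_robinLine_coe_iff, reflect_apply, neg_eq_iff_eq_neg]

lemma boundaryCondition_iff {Ω : TopologicalSpace.Opens ℝ} {p : ℝ} {ψ : ℝ → ℂ} :
    BoundaryCondition Ω p α ψ ↔ (ψ p, d1 Ω ψ p) ∈ robinLine α := by
  cases α using OnePoint.rec with
  | infty => simp [BoundaryCondition, mem_robinLine_infty_iff]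
  | coe a => simp [BoundaryCondition, mem_robinLine_coe_iff]

end BoundaryLines

section Graphs

variable {Ω : TopologicalSpace.Opens ℝ} {ψ u p : ℝ → ℂ} {f g : L2 Ω}
  {bc : Set (ℝ × OnePoint ℝ)}

lemma IsAC2.isH2On_of_mem_graph (hΩ : IsRegular Ω) (hψ : IsAC2 Ω ψ)
    (hf : f =ᵐ[volume.restrict (Ω : Set ℝ)] ψ) (hfg : (f, g) ∈ (maxOperator Ω).graph) :
    IsH2On Ω ψ (d1 Ω ψ) (-⇑g) := by
  obtain ⟨f', rfl, rfl⟩ := (LinearPMap.mem_graph_iff _).1 hfg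
  refine (IsH2On.of_isAC2 hΩ hψ ((Lp.memLp _).ae_eq hf)).congr_deriv_deriv hΩ.ae_eq_closure ?_
  have hg : maxOperator Ω f' =ᵐ[volume.restrict (Ω : Set ℝ)] fun x => -d2 Ω ψ x :=
    negSecondDeriv_ae f' hψ hf
  filter_upwards [hg] with x hx
  rw [Pi.neg_apply, hx, neg_neg]

lemma IsH2On.mem_graph_maxOperator (hΩ : IsRegular Ω) (hu : IsH2On Ω u p (-⇑g))
    (hf : f =ᵐ[volume.restrict (Ω : Set ℝ)] u) : (f, g) ∈ (maxOperator Ω).graph := by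
  refine (LinearPMap.mem_graph_iff _).2 ⟨⟨f, u, hu.isAC2 hΩ, hf⟩, rfl, Lp.ext ?_⟩
  refine (negSecondDeriv_ae ⟨f, u, hu.isAC2 hΩ, hf⟩ (hu.isAC2 hΩ) hf).trans ?_
  filter_upwards [hu.d2_ae_eq hΩ] with x hx
  rw [hx, Pi.neg_apply, neg_neg]

lemma mem_graph_maxOperator_iff (hΩ : IsRegular Ω) : (f, g) ∈ (maxOperator Ω).graph ↔
    ∃ u p, IsH2On Ω u p (-⇑g) ∧ f =ᵐ[volume.restrict (Ω : Set ℝ)] u := by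
  refine ⟨fun h => ?_, fun ⟨u, p, hu, hf⟩ => hu.mem_graph_maxOperator hΩ hf⟩
  obtain ⟨ψ, hψ, hf⟩ : f ∈ (maxOperator Ω).domain := LinearPMap.mem_domain_of_mem_graph h
  exact ⟨ψ, _, hψ.isH2On_of_mem_graph hΩ hf h, hf⟩

lemma mem_graph_boundaryOperator_iff (hΩ : IsRegular Ω)
    (hbc : ∀ b ∈ bc, b.1 ∈ closure (Ω : Set ℝ)) :
    (f, g) ∈ (boundaryOperator Ω bc).graph ↔
      ∃ u p, IsH2On Ω u p (-⇑g) ∧ f =ᵐ[volume.restrict (Ω : Set ℝ)] u ∧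
        ∀ b ∈ bc, (u b.1, p b.1) ∈ robinLine b.2 := by
  rw [boundaryOperator, mem_graph_domRestrict_iff]
  constructor
  · rintro ⟨⟨ψ, hψ, hf, hbc⟩, hfg⟩
    exact ⟨ψ, _, hψ.isH2On_of_mem_graph hΩ hf hfg, hf, fun b hb =>
      boundaryCondition_iff.1 (hbc b hb)⟩
  · rintro ⟨u, p, hu, hf, h⟩
    refine ⟨⟨u, hu.isAC2 hΩ, hf, fun b hb => boundaryCondition_iff.2 ?_⟩,
      hu.mem_graph_maxOperator hΩ hf⟩
    rw [hu.eqOn_d1 hΩ (hbc b hb)]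
    exact h b hb

end Graphs

/-- `f` belongs to the maximal domain on `Ω_Λ`, `g = -f''`, and the boundary values `(f, f')` are
`l` at `-Λ` and `r` at `Λ`. -/
def HasBoundaryData {Λ : ℝ} (f g : L2 (islands Λ)) (l r : ℂ × ℂ) : Prop :=
  ∃ u p, IsH2On (islands Λ : Set ℝ) u p (-⇑g) ∧ f =ᵐ[volume.restrict (islands Λ : Set ℝ)] u ∧
    (u (-Λ), p (-Λ)) = l ∧ (u Λ, p Λ) = r

section Islands

variable {Λ : ℝ} {f g f' g' : L2 (islands Λ)} {l r l' r' : ℂ × ℂ}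

lemma coe_islands (Λ : ℝ) : (islands Λ : Set ℝ) = Iio (-Λ) ∪ Ioi Λ := rfl

lemma disjoint_Iic_neg_Ici (hΛ : 0 < Λ) : Disjoint (Iic (-Λ)) (Ici Λ) :=
  disjoint_left.2 fun x h k => by linarith [mem_Iic.1 h, mem_Ici.1 k]

lemma isRegular_islands (hΛ : 0 < Λ) : IsRegular (islands Λ : Set ℝ) :=
  (isRegular_Iio _).union (isRegular_Ioi _) (by
    rw [closure_Iio, closure_Ioi]
    exact disjoint_Iic_neg_Ici hΛ)

lemma HasBoundaryData.of_sides (hΛ : 0 < Λ) {u p v q : ℝ → ℂ} (hu : IsH2On (Iio (-Λ)) u p (-⇑g))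
    (hv : IsH2On (Ioi Λ) v q (-⇑g)) (hfu : f =ᵐ[volume.restrict (Iio (-Λ))] u)
    (hfv : f =ᵐ[volume.restrict (Ioi Λ)] v) :
    HasBoundaryData f g (u (-Λ), p (-Λ)) (v Λ, q Λ) := by
  classical
  have mem_left : -Λ ∈ Iic (-Λ) := self_mem_Iic
  have notMem_right : Λ ∉ Iic (-Λ) := disjoint_right.1 (disjoint_Iic_neg_Ici hΛ) self_mem_Ici
  have hglue := hu.piecewise (A := Iic (-Λ)) measurableSet_Iic (closure_Iio (-Λ)).le
    ((closure_Ioi Λ).symm ▸ (disjoint_Iic_neg_Ici hΛ).symm) hv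
  rw [piecewise_same] at hglue
  refine ⟨_, _, hglue, ?_, by simp only [piecewise_eq_of_mem _ _ _ mem_left],
    by simp only [piecewise_eq_of_notMem _ _ _ notMem_right]⟩
  refine ae_restrict_union_iff _ _ _ |>.2 ⟨?_, ?_⟩
  · filter_upwards [hfu, ae_restrict_mem measurableSet_Iio] with x hx hxl
    rw [hx, piecewise_eq_of_mem _ _ _ (Iio_subset_Iic_self hxl)]
  · filter_upwards [hfv, ae_restrict_mem measurableSet_Ioi] with x hx hxr
    rw [hx, piecewise_eq_of_notMem _ _ _
      (disjoint_right.1 (disjoint_Iic_neg_Ici hΛ) (Ioi_subset_Ici_self hxr))]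

lemma HasBoundaryData.add (hΛ : 0 < Λ) (h : HasBoundaryData f g l r)
    (h' : HasBoundaryData f' g' l' r') : HasBoundaryData (f + f') (g + g') (l + l') (r + r') := by
  obtain ⟨u, p, hu, hf, rfl, rfl⟩ := h
  obtain ⟨v, q, hv, hf', rfl, rfl⟩ := h'
  refine ⟨u + v, p + q, (hu.add hv).congr_deriv_deriv (isRegular_islands hΛ).ae_eq_closure ?_,
    (Lp.coeFn_add f f').trans (hf.add hf'), rfl, rfl⟩
  rw [← neg_add]
  exact (Lp.coeFn_add g g').neg

lemma HasBoundaryData.smul (hΛ : 0 < Λ) (c : ℂ) (h : HasBoundaryData f g l r) :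
    HasBoundaryData (c • f) (c • g) (c • l) (c • r) := by
  obtain ⟨u, p, hu, hf, rfl, rfl⟩ := h
  refine ⟨c • u, c • p,
    (hu.const_smul c).congr_deriv_deriv (isRegular_islands hΛ).ae_eq_closure ?_,
    (Lp.coeFn_smul c f).trans (hf.const_smul c), rfl, rfl⟩
  rw [smul_neg]
  exact (Lp.coeFn_smul c g).neg

lemma mem_graph_maxOperator_islands_iff (hΛ : 0 < Λ) :
    (f, g) ∈ (maxOperator (islands Λ)).graph ↔ ∃ l r, HasBoundaryData f g l r := by
  rw [mem_graph_maxOperator_iff (isRegular_islands hΛ)]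
  exact ⟨fun ⟨u, p, hu, hf⟩ => ⟨_, _, u, p, hu, hf, rfl, rfl⟩,
    fun ⟨_, _, u, p, hu, hf, _, _⟩ => ⟨u, p, hu, hf⟩⟩

lemma mem_graph_Halpha_iff (hΛ : 0 < Λ) {αL αR : OnePoint ℝ} :
    (f, g) ∈ (Halpha Λ αL αR).graph ↔
      ∃ l ∈ robinLine αL, ∃ r ∈ robinLine αR, HasBoundaryData f g l r := by
  rw [Halpha, mem_graph_boundaryOperator_iff (isRegular_islands hΛ)]
  · simp only [mem_insert_iff, mem_singleton_iff, forall_eq_or_imp, forall_eq]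
    constructor
    · rintro ⟨u, p, hu, hf, hl, hr⟩
      exact ⟨_, hl, _, hr, u, p, hu, hf, rfl, rfl⟩
    · rintro ⟨_, hl, _, hr, u, p, hu, hf, rfl, rfl⟩
      exact ⟨u, p, hu, hf, hl, hr⟩
  · rw [coe_islands, closure_union, closure_Iio, closure_Ioi]
    rintro b (rfl | rfl)
    exacts [Or.inl self_mem_Iic, Or.inr self_mem_Ici]

lemma HasBoundaryData.inner_sub_inner (hΛ : 0 < Λ) (h : HasBoundaryData f g l r)
    (h' : HasBoundaryData f' g' l' r') :
    inner ℂ g f' - inner ℂ f g' = wronskian l l' - wronskian r r' := by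
  obtain ⟨u, p, hu, hf, rfl, rfl⟩ := h
  obtain ⟨v, q, hv, hf', rfl, rfl⟩ := h'
  have green_left := (hu.mono subset_union_left).star.integral_Iio_mul_sub_mul
    (hv.mono subset_union_left)
  have green_right := (hu.mono subset_union_right).star.integral_Ioi_mul_sub_mul
    (hv.mono subset_union_right)
  calc inner ℂ g f' - inner ℂ f g'
    _ = ∫ x in Iio (-Λ) ∪ Ioi Λ, (star u x * (-⇑g') x - star (-⇑g) x * v x) := by
      rw [L2.inner_def, L2.inner_def,
        ← integral_sub (L2.integrable_inner _ _) (L2.integrable_inner _ _)]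
      refine integral_congr_ae ?_
      filter_upwards [hf, hf'] with x hx hx'
      simp only [hx, hx', RCLike.inner_apply, Pi.star_apply, Pi.neg_apply, star_neg,
        RCLike.star_def]
      ring
    _ = _ := by
      rw [setIntegral_union (((disjoint_Iic_neg_Ici hΛ).mono_left Iio_subset_Iic_self).mono_right
        Ioi_subset_Ici_self) measurableSet_Ioi
        ((hu.mono subset_union_left).star.integrableOn_mul_sub_mul (hv.mono subset_union_left))
        ((hu.mono subset_union_right).star.integrableOn_mul_sub_mul (hv.mono subset_union_right)),
        green_left, green_right]
      simp only [wronskian, Pi.star_apply, RCLike.star_def]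
      ring

end Islands

lemma ofReal_sqrt_two_sq : ((√2 : ℝ) : ℂ) ^ 2 = 2 := by
  rw [← Complex.ofReal_pow, Real.sq_sqrt zero_le_two, Complex.ofReal_ofNat]

lemma ofReal_sqrt_two_ne_zero : ((√2 : ℝ) : ℂ) ≠ 0 :=
  Complex.ofReal_ne_zero.2 (Real.sqrt_ne_zero'.2 two_pos)

lemma isH2On_const_mul_cexp {S : Set ℝ} {c z : ℂ}
    (h : MemLp (fun x : ℝ => c * Complex.exp (z * x / (√2 : ℝ))) 2 (volume.restrict S)) :
    IsH2On S (fun x : ℝ => c * Complex.exp (z * x / (√2 : ℝ)))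
      ((z / (√2 : ℝ)) • fun x : ℝ => c * Complex.exp (z * x / (√2 : ℝ)))
      ((z ^ 2 / 2) • fun x : ℝ => c * Complex.exp (z * x / (√2 : ℝ))) := by
  set e : ℝ → ℂ := fun x => c * Complex.exp (z * x / (√2 : ℝ)) with he
  have e_deriv (x : ℝ) : HasDerivAt e (((z / (√2 : ℝ)) • e) x) x := by
    have hlin : HasDerivAt (fun x : ℝ => z * (x : ℂ) / (√2 : ℝ)) (z / (√2 : ℝ)) x := by
      simpa using ((hasDerivAt_id x).ofReal_comp.const_mul z).div_const ((√2 : ℝ) : ℂ)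
    refine (hlin.cexp.const_mul c).congr_deriv ?_
    simp only [he, Pi.smul_apply, smul_eq_mul]
    ring
  have e_cont : Continuous e := by fun_prop
  have primitive : IsPrimitiveOn (closure S) e ((z / (√2 : ℝ)) • e) :=
    .of_hasDerivAt e_deriv (e_cont.const_smul _)
  have sq_smul : (z ^ 2 / 2) • e = (z / (√2 : ℝ)) • (z / (√2 : ℝ)) • e := by
    rw [smul_smul, ← sq, div_pow, ofReal_sqrt_two_sq]
  refine ⟨primitive, ?_, h, h.const_smul _⟩
  rw [sq_smul]
  exact primitive.clm_comp ((z / (√2 : ℝ)) • ContinuousLinearMap.id ℝ ℂ)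

lemma isH2On_zero (S : Set ℝ) : IsH2On S 0 0 0 := by
  refine ⟨?_, ?_, MemLp.zero, MemLp.zero⟩ <;> exact isPrimitiveOn_const _ 0

/-- The boundary values of `x ↦ N e^{zx/√2}` at `-Λ`. -/
def expData (Λ : ℝ) (z : ℂ) : ℂ × ℂ :=
  (normFactor Λ * Complex.exp (z * (-Λ : ℝ) / (√2 : ℝ))) • (1, z / (√2 : ℝ))

section Exponentials

variable {Λ : ℝ} {f : L2 (islands Λ)} {z w : ℂ}

lemma neg_coeFn_smul_ae_eq {c : ℂ} {S : Set ℝ} {u : ℝ → ℂ} (hS : S ⊆ islands Λ)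
    (hf : f =ᵐ[volume.restrict S] u) : (-⇑(-c • f)) =ᵐ[volume.restrict S] c • u := by
  filter_upwards [hf, ae_restrict_of_ae_restrict_of_subset hS (Lp.coeFn_smul (-c) f)] with x hx hcx
  rw [Pi.neg_apply, hcx, Pi.smul_apply, hx, neg_smul, neg_neg, Pi.smul_apply]

lemma HasBoundaryData.of_ae_eq_indicator_Iio (hΛ : 0 < Λ) (hzw : -(z ^ 2 / 2) = w)
    (hf : f =ᵐ[volume.restrict (islands Λ : Set ℝ)]
      (Iio (-Λ)).indicator fun x : ℝ => normFactor Λ * Complex.exp (z * x / (√2 : ℝ))) :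
    HasBoundaryData f (w • f) (expData Λ z) 0 := by
  set e : ℝ → ℂ := fun x => normFactor Λ * Complex.exp (z * x / (√2 : ℝ)) with he
  have hleft : f =ᵐ[volume.restrict (Iio (-Λ))] e :=
    EventuallyEq.trans (ae_restrict_of_ae_restrict_of_subset subset_union_left hf)
      (indicator_ae_eq_restrict measurableSet_Iio)
  have hright : f =ᵐ[volume.restrict (Ioi Λ)] 0 :=
    EventuallyEq.trans (ae_restrict_of_ae_restrict_of_subset subset_union_right hf)
      (ae_restrict_of_ae_restrict_of_subset (fun x hx => not_lt.2 (by linarith [mem_Ioi.1 hx]))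
        (indicator_ae_eq_restrict_compl measurableSet_Iio))
  have memLp_left : MemLp e 2 (volume.restrict (Iio (-Λ))) :=
    ((Lp.memLp f).mono_measure (Measure.restrict_mono subset_union_left le_rfl)).ae_eq hleft
  have boundary_values : expData Λ z = (e (-Λ), ((z / (√2 : ℝ)) • e) (-Λ)) := by
    simp [expData, he, mul_comm]
  rw [boundary_values, ← hzw]
  exact .of_sides hΛ
    ((isH2On_const_mul_cexp memLp_left).congr_deriv_deriv (isRegular_Iio _).ae_eq_closure
      (neg_coeFn_smul_ae_eq subset_union_left hleft))
    ((isH2On_zero _).congr_deriv_deriv (isRegular_Ioi _).ae_eq_closure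
      ((neg_coeFn_smul_ae_eq subset_union_right hright).trans (by rw [smul_zero]))) hleft hright

lemma HasBoundaryData.of_ae_eq_indicator_Ioi (hΛ : 0 < Λ) (hzw : -(z ^ 2 / 2) = w)
    (hf : f =ᵐ[volume.restrict (islands Λ : Set ℝ)]
      (Ioi Λ).indicator fun x : ℝ => normFactor Λ * Complex.exp (-z * x / (√2 : ℝ))) :
    HasBoundaryData f (w • f) 0 (reflect (expData Λ z)) := by
  set e : ℝ → ℂ := fun x => normFactor Λ * Complex.exp (-z * x / (√2 : ℝ)) with he
  have hleft : f =ᵐ[volume.restrict (Iio (-Λ))] 0 :=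
    EventuallyEq.trans (ae_restrict_of_ae_restrict_of_subset subset_union_left hf)
      (ae_restrict_of_ae_restrict_of_subset (fun x hx => not_lt.2 (by linarith [mem_Iio.1 hx]))
        (indicator_ae_eq_restrict_compl measurableSet_Ioi))
  have hright : f =ᵐ[volume.restrict (Ioi Λ)] e :=
    EventuallyEq.trans (ae_restrict_of_ae_restrict_of_subset subset_union_right hf)
      (indicator_ae_eq_restrict measurableSet_Ioi)
  have memLp_right : MemLp e 2 (volume.restrict (Ioi Λ)) :=
    ((Lp.memLp f).mono_measure (Measure.restrict_mono subset_union_right le_rfl)).ae_eq hright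
  have boundary_values : reflect (expData Λ z) = (e Λ, ((-z / (√2 : ℝ)) • e) Λ) := by
    simp [reflect_apply, expData, he, mul_comm, neg_div]
  rw [boundary_values, ← hzw, ← neg_sq]
  exact .of_sides hΛ
    ((isH2On_zero _).congr_deriv_deriv (isRegular_Iio _).ae_eq_closure
      ((neg_coeFn_smul_ae_eq subset_union_left hleft).trans (by rw [smul_zero])))
    ((isH2On_const_mul_cexp memLp_right).congr_deriv_deriv (isRegular_Ioi _).ae_eq_closure
      (neg_coeFn_smul_ae_eq subset_union_right hright)) hleft hright

end Exponentials

/-- A real vector on the line of the boundary condition with parameter `alphaLeft θ`. -/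
def angleVector (θ : ℝ) : ℂ × ℂ :=
  ((Real.cos (θ / 2) : ℝ), ((Real.cos (θ / 2) - Real.sin (θ / 2)) / √2 : ℝ))

section DeficiencyVectors

variable {Λ : ℝ}

lemma normFactor_ne_zero (Λ : ℝ) : normFactor Λ ≠ 0 := by
  rw [normFactor, Complex.ofReal_ne_zero]
  positivity

lemma neg_sq_one_sub_I_div_two : -((1 - Complex.I) ^ 2 / 2) = Complex.I := by
  linear_combination -Complex.I_sq / 2

lemma neg_sq_one_add_I_div_two : -((1 + Complex.I) ^ 2 / 2) = -Complex.I := by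
  linear_combination -Complex.I_sq / 2

lemma hasBoundaryData_Lplus (hΛ : 0 < Λ) :
    HasBoundaryData (Lplus Λ) (Complex.I • Lplus Λ) (expData Λ (1 - Complex.I)) 0 :=
  .of_ae_eq_indicator_Iio hΛ neg_sq_one_sub_I_div_two (MemLp.coeFn_toLp _)

lemma hasBoundaryData_Lminus (hΛ : 0 < Λ) :
    HasBoundaryData (Lminus Λ) (-Complex.I • Lminus Λ) (expData Λ (1 + Complex.I)) 0 :=
  .of_ae_eq_indicator_Iio hΛ neg_sq_one_add_I_div_two (MemLp.coeFn_toLp _)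

lemma hasBoundaryData_Rplus (hΛ : 0 < Λ) :
    HasBoundaryData (Rplus Λ) (Complex.I • Rplus Λ) 0 (reflect (expData Λ (1 - Complex.I))) := by
  refine .of_ae_eq_indicator_Ioi hΛ neg_sq_one_sub_I_div_two ?_
  rw [neg_sub, sub_eq_neg_add]
  exact MemLp.coeFn_toLp _

lemma hasBoundaryData_Rminus (hΛ : 0 < Λ) :
    HasBoundaryData (Rminus Λ) (-Complex.I • Rminus Λ) 0 (reflect (expData Λ (1 + Complex.I))) := by
  refine .of_ae_eq_indicator_Ioi hΛ neg_sq_one_add_I_div_two ?_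
  rw [neg_add']
  exact MemLp.coeFn_toLp _

lemma exists_expData_combination (Λ : ℝ) (l : ℂ × ℂ) :
    ∃ a b : ℂ, a • expData Λ (1 - Complex.I) + b • expData Λ (1 + Complex.I) = l := by
  have exists_smul (z : ℂ) : ∃ k : ℂ, k • expData Λ z = (1, z / (√2 : ℝ)) :=
    ⟨_, inv_smul_smul₀ (mul_ne_zero (normFactor_ne_zero Λ) (Complex.exp_ne_zero _)) _⟩
  obtain ⟨k, hk⟩ := exists_smul (1 - Complex.I)
  obtain ⟨k', hk'⟩ := exists_smul (1 + Complex.I)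
  obtain ⟨x, y⟩ := l
  set s : ℂ := ((√2 : ℝ) : ℂ)
  refine ⟨(x + Complex.I * (s * y - x)) / 2 * k, (x - Complex.I * (s * y - x)) / 2 * k', ?_⟩
  rw [mul_smul, mul_smul, hk, hk']
  have hs0 : s ≠ 0 := ofReal_sqrt_two_ne_zero
  refine Prod.ext ?_ ?_ <;>
    simp only [Prod.fst_add, Prod.snd_add, Prod.smul_fst, Prod.smul_snd, smul_eq_mul]
  · ring
  · field_simp
    linear_combination 2 * (x - s * y) * Complex.I_sq

lemma exists_hasBoundaryData (hΛ : 0 < Λ) (l r : ℂ × ℂ) :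
    ∃ f g : L2 (islands Λ), HasBoundaryData f g l r := by
  obtain ⟨a, b, hl⟩ := exists_expData_combination Λ l
  obtain ⟨c, d, hr⟩ := exists_expData_combination Λ (reflect r)
  have hr' : c • reflect (expData Λ (1 - Complex.I)) +
      d • reflect (expData Λ (1 + Complex.I)) = r := by
    rw [← map_smul, ← map_smul, ← map_add, hr, reflect_reflect]
  have hleft := ((hasBoundaryData_Lplus hΛ).smul hΛ a).add hΛ
    ((hasBoundaryData_Lminus hΛ).smul hΛ b)
  have hright := ((hasBoundaryData_Rplus hΛ).smul hΛ c).add hΛ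
    ((hasBoundaryData_Rminus hΛ).smul hΛ d)
  have hsum := hleft.add hΛ hright
  simp only [smul_zero, add_zero, zero_add, hl, hr'] at hsum
  exact ⟨_, _, hsum⟩

lemma expData_add_phase_smul_expData (Λ θ : ℝ) :
    expData Λ (1 - Complex.I) + phase Λ θ • expData Λ (1 + Complex.I) =
      (normFactor Λ * Complex.exp ((-1 + Complex.I) * Λ / (√2 : ℝ))) •
        (1 + Complex.exp (θ * Complex.I),
          ((1 - Complex.I) + (1 + Complex.I) * Complex.exp (θ * Complex.I)) / (√2 : ℝ)) := by
  have hplus : Complex.exp ((1 - Complex.I) * (-Λ : ℝ) / (√2 : ℝ)) =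
      Complex.exp ((-1 + Complex.I) * Λ / (√2 : ℝ)) := by
    push_cast
    ring_nf
  have hminus : phase Λ θ * Complex.exp ((1 + Complex.I) * (-Λ : ℝ) / (√2 : ℝ)) =
      Complex.exp ((-1 + Complex.I) * Λ / (√2 : ℝ)) * Complex.exp (θ * Complex.I) := by
    rw [phase, ← Complex.exp_add, ← Complex.exp_add]
    congr 1
    have hs0 := ofReal_sqrt_two_ne_zero
    push_cast
    field_simp
    linear_combination (Complex.I * Λ) * ofReal_sqrt_two_sq
  rw [expData, expData, smul_smul, mul_left_comm, hplus, hminus]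
  refine Prod.ext ?_ ?_ <;>
    simp only [Prod.fst_add, Prod.snd_add, Prod.smul_fst, Prod.smul_snd, smul_eq_mul] <;> ring

lemma exists_smul_angleVector (Λ θ : ℝ) : ∃ c : ℂ, c ≠ 0 ∧
    expData Λ (1 - Complex.I) + phase Λ θ • expData Λ (1 + Complex.I) = c • angleVector θ := by
  set E : ℂ := Complex.exp (θ / 2 * Complex.I) with hE
  have hE0 : E ≠ 0 := Complex.exp_ne_zero _
  have hE_sq : Complex.exp (θ * Complex.I) = E ^ 2 := by
    rw [hE, ← Complex.exp_nat_mul]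
    ring_nf
  have hcos : 2 * E * Complex.cos (θ / 2) = E ^ 2 + 1 := by
    rw [Complex.cos, neg_mul, Complex.exp_neg, ← hE]
    field_simp
  have hsin : 2 * E * Complex.sin (θ / 2) = (1 - E ^ 2) * Complex.I := by
    rw [Complex.sin, neg_mul, Complex.exp_neg, ← hE]
    field_simp
  rw [expData_add_phase_smul_expData, hE_sq]
  set A : ℂ := normFactor Λ * Complex.exp ((-1 + Complex.I) * Λ / (√2 : ℝ)) with hA
  refine ⟨2 * A * E, by simp [normFactor_ne_zero, hA, hE0], ?_⟩
  refine Prod.ext ?_ ?_ <;> simp only [angleVector, Prod.smul_fst, Prod.smul_snd, smul_eq_mul] <;>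
    push_cast
  · linear_combination -A * hcos
  · linear_combination (-A / (√2 : ℝ)) * (hcos - hsin)

end DeficiencyVectors

/-! ### Self-adjoint restrictions -/

section MinimalOperator

variable {Λ : ℝ} {f g : L2 (islands Λ)}

lemma d1_eq_zero_of_notMem_tsupport {Ω : TopologicalSpace.Opens ℝ} {φ : ℝ → ℂ} {x : ℝ}
    (hx : x ∉ tsupport φ) : d1 Ω φ x = 0 := by
  have hzero : φ =ᶠ[𝓝 x] fun _ => 0 := notMem_tsupport_iff_eventuallyEq.1 hx
  rw [d1, (hzero.filter_mono nhdsWithin_le_nhds).derivWithin_eq hzero.eq_of_nhds,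
    derivWithin_fun_const, Pi.zero_apply]

lemma hasBoundaryData_of_mem_graph_H00 (hΛ : 0 < Λ) (h : (f, g) ∈ (H00 Λ).graph) :
    HasBoundaryData f g 0 0 := by
  obtain ⟨⟨φ, hφ, hc, hs, hf⟩, hfg⟩ := mem_graph_domRestrict_iff.1 h
  have data_eq_zero (x : ℝ) (hx : x ∉ islands Λ) : (φ x, d1 (islands Λ) φ x) = 0 := by
    have hxs : x ∉ tsupport φ := fun k => hx (hs k)
    rw [image_eq_zero_of_notMem_tsupport hxs, d1_eq_zero_of_notMem_tsupport hxs]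
    rfl
  refine ⟨φ, _, (isAC2_of_contDiff hφ hc hs).isH2On_of_mem_graph (isRegular_islands hΛ) hf hfg, hf,
    data_eq_zero _ ?_, data_eq_zero _ ?_⟩
  · rintro (h | h)
    exacts [lt_irrefl _ (mem_Iio.1 h), (neg_lt_self hΛ).not_gt h]
  · rintro (h | h)
    exacts [(neg_lt_self hΛ).not_gt h, lt_irrefl _ (mem_Ioi.1 h)]

lemma exists_hasBoundaryData_of_mem_adjoint_graph_H00 (hΛ : 0 < Λ)
    (hfg : (f, g) ∈ (H00 Λ).graph.adjoint) : ∃ l r, HasBoundaryData f g l r := by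
  have exists_rep {S : Set ℝ} [S.OrdConnected] (hS : IsOpen S) (hne : S.Nonempty)
      (hreg : IsRegular S) (hsub : S ⊆ islands Λ) :
      ∃ u p, IsH2On S u p (-⇑g) ∧ f =ᵐ[volume.restrict S] u := by
    have hle := Measure.restrict_mono_set volume hsub
    obtain ⟨u, p, hu, hf⟩ := exists_isH2On_of_integral_deriv_deriv_smul_eq hS hne
      ((Lp.memLp f).mono_measure hle) ((Lp.memLp (-g)).mono_measure hle)
      fun φ hφ => (hφ.mono hsub).integral_deriv_deriv_smul_of_mem_adjoint hfg
    have hneg : ⇑(-g) =ᵐ[volume.restrict S] -⇑g := ae_mono hle (Lp.coeFn_neg g)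
    exact ⟨u, p, hu.congr_deriv_deriv hreg.ae_eq_closure hneg.symm, hf⟩
  obtain ⟨u, p, hu, hfu⟩ := exists_rep isOpen_Iio nonempty_Iio (isRegular_Iio (-Λ))
    subset_union_left
  obtain ⟨v, q, hv, hfv⟩ := exists_rep isOpen_Ioi nonempty_Ioi (isRegular_Ioi Λ)
    subset_union_right
  exact ⟨_, _, .of_sides hΛ hu hv hfu hfv⟩

lemma mem_adjoint_graph_H00_iff (hΛ : 0 < Λ) :
    (f, g) ∈ (H00 Λ).graph.adjoint ↔ ∃ l r, HasBoundaryData f g l r := by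
  refine ⟨exists_hasBoundaryData_of_mem_adjoint_graph_H00 hΛ, fun ⟨l, r, h⟩ => ?_⟩
  refine (Submodule.mem_adjoint_iff _ _).2 fun a b hab => ?_
  rw [(hasBoundaryData_of_mem_graph_H00 hΛ hab).inner_sub_inner hΛ h, wronskian_zero_left,
    wronskian_zero_left, sub_zero]

lemma mem_adjoint_iff_of_forall_mem_iff (hΛ : 0 < Λ)
    {G : Submodule ℂ (L2 (islands Λ) × L2 (islands Λ))} {P : ℂ × ℂ → ℂ × ℂ → Prop} (hP : P 0 0)
    (hG : ∀ a b, (a, b) ∈ G ↔ ∃ l r, P l r ∧ HasBoundaryData a b l r) :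
    (f, g) ∈ G.adjoint ↔ ∃ l' r', HasBoundaryData f g l' r' ∧
      ∀ l r, P l r → wronskian l l' - wronskian r r' = 0 := by
  constructor
  · intro hfg
    have hH00 : (f, g) ∈ (H00 Λ).graph.adjoint := (Submodule.mem_adjoint_iff _ _).2 fun a b hab =>
      (Submodule.mem_adjoint_iff _ _).1 hfg a b
        ((hG a b).2 ⟨0, 0, hP, hasBoundaryData_of_mem_graph_H00 hΛ hab⟩)
    obtain ⟨l', r', h⟩ := (mem_adjoint_graph_H00_iff hΛ).1 hH00
    refine ⟨l', r', h, fun l r hlr => ?_⟩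
    obtain ⟨a, b, hab⟩ := exists_hasBoundaryData hΛ l r
    rw [← hab.inner_sub_inner hΛ h]
    exact (Submodule.mem_adjoint_iff _ _).1 hfg a b ((hG a b).2 ⟨l, r, hlr, hab⟩)
  · rintro ⟨l', r', h, hzero⟩
    refine (Submodule.mem_adjoint_iff _ _).2 fun a b hab => ?_
    obtain ⟨l, r, hlr, hab⟩ := (hG a b).1 hab
    rw [hab.inner_sub_inner hΛ h, hzero l r hlr]

lemma dense_domain_H00 (Λ : ℝ) : Dense ((H00 Λ).domain : Set (L2 (islands Λ))) := by
  rw [H00_domain]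
  exact dense_testFunctions _

lemma adjoint_H00 (hΛ : 0 < Λ) : (H00 Λ)† = maxOperator (islands Λ) := by
  refine LinearPMap.eq_of_eq_graph ?_
  rw [LinearPMap.adjoint_graph_eq_graph_adjoint (dense_domain_H00 Λ)]
  ext ⟨f, g⟩
  rw [mem_adjoint_graph_H00_iff hΛ, mem_graph_maxOperator_islands_iff hΛ]

lemma isClosable_H00 (hΛ : 0 < Λ) : (H00 Λ).IsClosable := by
  refine LinearPMap.IsClosable.leIsClosable (f := maxOperator (islands Λ)) ?_
    LinearPMap.domRestrict_le
  rw [← adjoint_H00 hΛ]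
  exact (LinearPMap.adjoint_isClosed (dense_domain_H00 Λ)).isClosable

lemma adjoint_H0 (hΛ : 0 < Λ) : (H0 Λ)† = maxOperator (islands Λ) := by
  rw [H0, adjoint_closure_of_isClosable (dense_domain_H00 Λ) (isClosable_H00 hΛ), adjoint_H00 hΛ]

lemma mem_graph_H0_iff (hΛ : 0 < Λ) : (f, g) ∈ (H0 Λ).graph ↔ HasBoundaryData f g 0 0 := by
  rw [H0, graph_closure_eq_adjoint_graph_adjoint (dense_domain_H00 Λ) (isClosable_H00 hΛ),
    adjoint_H00 hΛ, mem_adjoint_iff_of_forall_mem_iff hΛ (P := fun _ _ => True) trivial]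
  · constructor
    · rintro ⟨l', r', h, hzero⟩
      obtain rfl : l' = 0 := eq_zero_of_forall_wronskian_eq_zero fun l => by
        simpa only [wronskian_zero_left, sub_zero] using hzero l 0 trivial
      obtain rfl : r' = 0 := eq_zero_of_forall_wronskian_eq_zero fun r => by
        simpa only [wronskian_zero_left, zero_sub, neg_eq_zero] using hzero 0 r trivial
      exact h
    · intro h
      exact ⟨0, 0, h, fun l r _ => by simp only [wronskian_zero_right, sub_zero]⟩
  · simp only [mem_graph_maxOperator_islands_iff hΛ, true_and, implies_true]

lemma H0_le_Halpha (hΛ : 0 < Λ) (αL αR : OnePoint ℝ) : H0 Λ ≤ Halpha Λ αL αR := by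
  refine LinearPMap.le_of_le_graph fun ⟨f, g⟩ h => (mem_graph_Halpha_iff hΛ).2 ?_
  exact ⟨0, zero_mem _, 0, zero_mem _, (mem_graph_H0_iff hΛ).1 h⟩

lemma adjoint_graph_Halpha (hΛ : 0 < Λ) (αL αR : OnePoint ℝ) :
    (Halpha Λ αL αR).graph.adjoint = (Halpha Λ αL αR).graph := by
  ext ⟨f, g⟩
  rw [mem_adjoint_iff_of_forall_mem_iff hΛ
    (P := fun l r => l ∈ robinLine αL ∧ r ∈ robinLine αR) ⟨zero_mem _, zero_mem _⟩,
    mem_graph_Halpha_iff hΛ]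
  · constructor
    · rintro ⟨l', r', h, hzero⟩
      refine ⟨l', mem_robinLine_iff_forall_wronskian_eq_zero.2 fun l hl => ?_, r',
        mem_robinLine_iff_forall_wronskian_eq_zero.2 fun r hr => ?_, h⟩
      · simpa only [wronskian_zero_left, sub_zero] using hzero l 0 ⟨hl, zero_mem _⟩
      · simpa only [wronskian_zero_left, zero_sub, neg_eq_zero] using hzero 0 r ⟨zero_mem _, hr⟩
    · rintro ⟨l', hl', r', hr', h⟩
      refine ⟨l', r', h, fun l r hlr => ?_⟩
      rw [mem_robinLine_iff_forall_wronskian_eq_zero.1 hl' l hlr.1,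
        mem_robinLine_iff_forall_wronskian_eq_zero.1 hr' r hlr.2, sub_zero]
  · intro a b
    rw [mem_graph_Halpha_iff hΛ]
    exact ⟨fun ⟨l, hl, r, hr, h⟩ => ⟨l, r, ⟨hl, hr⟩, h⟩,
      fun ⟨l, r, ⟨hl, hr⟩, h⟩ => ⟨l, hl, r, hr, h⟩⟩

lemma isSelfAdjoint_Halpha (hΛ : 0 < Λ) (αL αR : OnePoint ℝ) :
    IsSelfAdjoint (Halpha Λ αL αR) := by
  have hdense : Dense ((Halpha Λ αL αR).domain : Set (L2 (islands Λ))) :=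
    (dense_domain_H00 Λ).mono ((H00 Λ).le_closure.trans (H0_le_Halpha hΛ αL αR)).1
  rw [LinearPMap.isSelfAdjoint_def]
  refine LinearPMap.eq_of_eq_graph ?_
  rw [LinearPMap.adjoint_graph_eq_graph_adjoint hdense, adjoint_graph_Halpha hΛ]

end MinimalOperator

/-! ### Deficiency vectors and boundary conditions -/

section Angles

variable {θ : ℝ} {α : OnePoint ℝ}

lemma angleVector_ne_zero (θ : ℝ) : angleVector θ ≠ 0 := by
  intro h
  have hfst := congrArg Prod.fst h
  have hsnd := congrArg Prod.snd h
  simp only [angleVector, Prod.fst_zero, Prod.snd_zero, Complex.ofReal_eq_zero] at hfst hsnd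
  simp only [hfst, zero_sub, neg_div, neg_eq_zero, div_eq_zero_iff, Real.sqrt_ne_zero'.2 two_pos,
    or_false] at hsnd
  simpa only [hfst, hsnd, ne_eq, OfNat.ofNat_ne_zero, not_false_eq_true, zero_pow, add_zero,
    zero_ne_one] using Real.sin_sq_add_cos_sq (θ / 2)

lemma angleVector_add_two_pi (θ : ℝ) : angleVector (θ + 2 * Real.pi) = -angleVector θ := by
  rw [angleVector, angleVector, add_div, mul_div_cancel_left₀ _ two_ne_zero, Real.cos_add_pi,
    Real.sin_add_pi]
  refine Prod.ext (by simp) ?_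
  simp only [Prod.snd_neg, ← Complex.ofReal_neg]
  congr 1
  ring

lemma wronskian_angleVector (θ θ' : ℝ) :
    wronskian (angleVector θ) (angleVector θ') = (Real.sin ((θ - θ') / 2) / √2 : ℝ) := by
  rw [sub_div, Real.sin_sub, wronskian, angleVector, angleVector, Complex.conj_ofReal,
    Complex.conj_ofReal]
  push_cast
  ring

lemma cos_half_ne_zero (hθ : θ ∈ Ico 0 (2 * Real.pi)) (hπ : θ ≠ Real.pi) :
    Real.cos (θ / 2) ≠ 0 := by
  rw [← Real.cos_pi_div_two, Real.injOn_cos.ne_iff]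
  · exact fun h => hπ (by linarith)
  · constructor <;> linarith [hθ.1, hθ.2]
  · constructor <;> linarith [Real.pi_pos]

lemma angleVector_mem_robinLine_alphaLeft (hθ : θ ∈ Ico 0 (2 * Real.pi)) :
    angleVector θ ∈ robinLine (alphaLeft θ) := by
  by_cases hπ : θ = Real.pi
  · rw [alphaLeft, if_pos hπ, mem_robinLine_infty_iff, angleVector, hπ, Real.cos_pi_div_two,
      Complex.ofReal_zero]
  · have hcos := cos_half_ne_zero hθ hπ
    rw [alphaLeft, if_neg hπ, mem_robinLine_coe_iff, angleVector, ← Complex.ofReal_mul]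
    refine congrArg Complex.ofReal ?_
    obtain ⟨x, rfl⟩ : ∃ x, θ = 2 * x := ⟨θ / 2, by ring⟩
    rw [mul_div_cancel_left₀ _ two_ne_zero] at hcos ⊢
    rw [Real.cos_two_mul, Real.sin_two_mul, add_sub_cancel]
    field_simp

lemma alphaLeft_eq_iff (hθ : θ ∈ Ico 0 (2 * Real.pi)) :
    alphaLeft θ = α ↔ angleVector θ ∈ robinLine α := by
  refine ⟨fun h => h ▸ angleVector_mem_robinLine_alphaLeft hθ, fun h => robinLine_injective ?_⟩
  rw [robinLine_eq_span_singleton (angleVector_mem_robinLine_alphaLeft hθ) (angleVector_ne_zero θ),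
    robinLine_eq_span_singleton h (angleVector_ne_zero θ)]

lemma injOn_alphaLeft : InjOn alphaLeft (Ico 0 (2 * Real.pi)) := by
  intro θ hθ θ' hθ' h
  have hwronskian := mem_robinLine_iff_forall_wronskian_eq_zero.1
    (angleVector_mem_robinLine_alphaLeft hθ') _ ((alphaLeft_eq_iff hθ).1 h)
  rw [wronskian_angleVector, Complex.ofReal_eq_zero, div_eq_zero_iff,
    or_iff_left (Real.sqrt_ne_zero'.2 two_pos), Real.sin_eq_zero_iff_of_lt_of_lt
      (by linarith [hθ.1, hθ'.2]) (by linarith [hθ.2, hθ'.1])] at hwronskian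
  linarith

lemma angleVector_two_mul_arctan_mem_robinLine (a : ℝ) :
    angleVector (2 * Real.arctan (1 - √2 * a)) ∈ robinLine a := by
  rw [mem_robinLine_coe_iff, angleVector, mul_div_cancel_left₀ _ two_ne_zero, Real.sin_arctan,
    Real.cos_arctan, ← Complex.ofReal_mul]
  refine congrArg Complex.ofReal ?_
  field_simp
  ring

lemma surjOn_alphaLeft : SurjOn alphaLeft (Ico 0 (2 * Real.pi)) univ := by
  intro α _
  suffices ∃ θ ∈ Ico 0 (2 * Real.pi), angleVector θ ∈ robinLine α by
    obtain ⟨θ, hθ, h⟩ := this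
    exact ⟨θ, hθ, (alphaLeft_eq_iff hθ).2 h⟩
  cases α using OnePoint.rec with
  | infty =>
    refine ⟨Real.pi, ⟨Real.pi_pos.le, by linarith [Real.pi_pos]⟩, ?_⟩
    rw [mem_robinLine_infty_iff, angleVector, Real.cos_pi_div_two, Complex.ofReal_zero]
  | coe a =>
    have hmem := angleVector_two_mul_arctan_mem_robinLine a
    have hlower := Real.neg_pi_div_two_lt_arctan (1 - √2 * a)
    have hupper := Real.arctan_lt_pi_div_two (1 - √2 * a)
    rcases le_or_gt 0 (Real.arctan (1 - √2 * a)) with hsign | hsign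
    · exact ⟨_, ⟨by linarith, by linarith⟩, hmem⟩
    · refine ⟨_, ⟨?_, ?_⟩, angleVector_add_two_pi _ ▸ neg_mem hmem⟩ <;> linarith

lemma bijOn_alphaLeft : BijOn alphaLeft (Ico 0 (2 * Real.pi)) univ :=
  ⟨mapsTo_univ _ _, injOn_alphaLeft, surjOn_alphaLeft⟩

lemma alphaRight_eq_map_neg (θ : ℝ) : alphaRight θ = (alphaLeft θ).map Neg.neg := by
  rw [alphaLeft, alphaRight]
  split_ifs <;> rfl

lemma bijOn_alphaRight : BijOn alphaRight (Ico 0 (2 * Real.pi)) univ := by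
  have involutive_map_neg : Function.Involutive (OnePoint.map (Neg.neg : ℝ → ℝ)) := fun α => by
    cases α using OnePoint.rec with
    | infty => rfl
    | coe a => rw [OnePoint.map_some, OnePoint.map_some, neg_neg]
  exact ((bijOn_univ.2 involutive_map_neg.bijective).comp bijOn_alphaLeft).congr fun θ _ =>
    (alphaRight_eq_map_neg θ).symm

lemma reflect_angleVector_mem_robinLine_alphaRight (hθ : θ ∈ Ico 0 (2 * Real.pi)) :
    reflect (angleVector θ) ∈ robinLine (alphaRight θ) := by
  rw [alphaRight_eq_map_neg, mem_robinLine_map_neg_iff, reflect_reflect]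
  exact angleVector_mem_robinLine_alphaLeft hθ

end Angles

section GammaOperators

variable {Λ θL θR : ℝ} {f g : L2 (islands Λ)} {l r : ℂ × ℂ} {αL αR βL βR : OnePoint ℝ}

lemma exists_hasBoundaryData_left (hΛ : 0 < Λ) (θ : ℝ) : ∃ c : ℂ, c ≠ 0 ∧ ∃ g,
    HasBoundaryData (Lplus Λ + phase Λ θ • Lminus Λ) g (c • angleVector θ) 0 := by
  obtain ⟨c, hc, hdata⟩ := exists_smul_angleVector Λ θ
  have h := (hasBoundaryData_Lplus hΛ).add hΛ ((hasBoundaryData_Lminus hΛ).smul hΛ (phase Λ θ))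
  rw [hdata, smul_zero, add_zero] at h
  exact ⟨c, hc, _, h⟩

lemma exists_hasBoundaryData_right (hΛ : 0 < Λ) (θ : ℝ) : ∃ c : ℂ, c ≠ 0 ∧ ∃ g,
    HasBoundaryData (Rplus Λ + phase Λ θ • Rminus Λ) g 0 (c • reflect (angleVector θ)) := by
  obtain ⟨c, hc, hdata⟩ := exists_smul_angleVector Λ θ
  have h := (hasBoundaryData_Rplus hΛ).add hΛ ((hasBoundaryData_Rminus hΛ).smul hΛ (phase Λ θ))
  rw [← map_smul, ← map_add, hdata, smul_zero, add_zero, map_smul] at h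
  exact ⟨c, hc, _, h⟩

lemma gammaDomain_eq_domain_Halpha (hΛ : 0 < Λ) (hL : θL ∈ Ico 0 (2 * Real.pi))
    (hR : θR ∈ Ico 0 (2 * Real.pi)) : gammaDomain Λ (phase Λ θL) (phase Λ θR) =
      (Halpha Λ (alphaLeft θL) (alphaRight θR)).domain := by
  obtain ⟨c, hc, g, hleft⟩ := exists_hasBoundaryData_left hΛ θL
  obtain ⟨d, hd, g', hright⟩ := exists_hasBoundaryData_right hΛ θR
  have left_mem := Submodule.smul_mem _ c (angleVector_mem_robinLine_alphaLeft hL)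
  have right_mem := Submodule.smul_mem _ d (reflect_angleVector_mem_robinLine_alphaRight hR)
  have left_ne := smul_ne_zero hc (angleVector_ne_zero θL)
  have right_ne := smul_ne_zero hd (reflect.map_ne_zero_iff.2 (angleVector_ne_zero θR))
  refine le_antisymm ?_ fun f hf => ?_
  · rintro _ ⟨ψ₀, hψ₀, a, b, rfl⟩
    have left_mem_domain := LinearPMap.mem_domain_of_mem_graph
      ((mem_graph_Halpha_iff hΛ).2 ⟨_, left_mem, 0, zero_mem (robinLine (alphaRight θR)), hleft⟩)
    have right_mem_domain := LinearPMap.mem_domain_of_mem_graph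
      ((mem_graph_Halpha_iff hΛ).2 ⟨0, zero_mem (robinLine (alphaLeft θL)), _, right_mem, hright⟩)
    exact add_mem (add_mem ((H0_le_Halpha hΛ _ _).1 hψ₀) (Submodule.smul_mem _ a left_mem_domain))
      (Submodule.smul_mem _ b right_mem_domain)
  · obtain ⟨h, hfh⟩ := LinearPMap.mem_domain_iff.1 hf
    obtain ⟨l, hl, r, hr, hdata⟩ := (mem_graph_Halpha_iff hΛ).1 hfh
    rw [robinLine_eq_span_singleton left_mem left_ne, Submodule.mem_span_singleton] at hl
    rw [robinLine_eq_span_singleton right_mem right_ne, Submodule.mem_span_singleton] at hr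
    obtain ⟨a, rfl⟩ := hl
    obtain ⟨b, rfl⟩ := hr
    have hzero := (hdata.add hΛ (hleft.smul hΛ (-a))).add hΛ (hright.smul hΛ (-b))
    simp only [smul_zero, add_zero, neg_smul, add_neg_cancel] at hzero
    exact ⟨_, LinearPMap.mem_domain_of_mem_graph ((mem_graph_H0_iff hΛ).2 hzero), a, b, by abel⟩

lemma Hgamma_eq_Halpha (hΛ : 0 < Λ) (hL : θL ∈ Ico 0 (2 * Real.pi))
    (hR : θR ∈ Ico 0 (2 * Real.pi)) :
    Hgamma Λ (phase Λ θL) (phase Λ θR) = Halpha Λ (alphaLeft θL) (alphaRight θR) := by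
  rw [Hgamma, gammaDomain_eq_domain_Halpha hΛ hL hR, Halpha, boundaryOperator_domain,
    boundaryOperator]

lemma HasBoundaryData.mem_robinLine_of_mem_graph_Halpha (hΛ : 0 < Λ)
    (h : HasBoundaryData f g l r) (hfg : (f, g) ∈ (Halpha Λ αL αR).graph) :
    l ∈ robinLine αL ∧ r ∈ robinLine αR := by
  have wronskian_eq {m n : ℂ × ℂ} (hm : m ∈ robinLine αL) (hn : n ∈ robinLine αR) :
      wronskian m l - wronskian n r = 0 := by
    obtain ⟨f', g', h'⟩ := exists_hasBoundaryData hΛ m n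
    rw [← h'.inner_sub_inner hΛ h]
    exact (Submodule.mem_adjoint_iff _ _).1 ((adjoint_graph_Halpha hΛ αL αR).ge hfg) _ _
      ((mem_graph_Halpha_iff hΛ).2 ⟨m, hm, n, hn, h'⟩)
  constructor <;> refine mem_robinLine_iff_forall_wronskian_eq_zero.2 fun m hm => ?_
  · simpa only [wronskian_zero_left, sub_zero] using wronskian_eq hm (zero_mem _)
  · simpa only [wronskian_zero_left, zero_sub, neg_eq_zero] using wronskian_eq (zero_mem _) hm

lemma robinLine_le_of_Halpha_le (hΛ : 0 < Λ) (h : Halpha Λ αL αR ≤ Halpha Λ βL βR) :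
    robinLine αL ≤ robinLine βL ∧ robinLine αR ≤ robinLine βR := by
  constructor <;> intro m hm
  · obtain ⟨f, g, hdata⟩ := exists_hasBoundaryData hΛ m 0
    exact (hdata.mem_robinLine_of_mem_graph_Halpha hΛ (LinearPMap.le_graph_of_le h
      ((mem_graph_Halpha_iff hΛ).2 ⟨m, hm, 0, zero_mem _, hdata⟩))).1
  · obtain ⟨f, g, hdata⟩ := exists_hasBoundaryData hΛ 0 m
    exact (hdata.mem_robinLine_of_mem_graph_Halpha hΛ (LinearPMap.le_graph_of_le h
      ((mem_graph_Halpha_iff hΛ).2 ⟨0, zero_mem _, m, hm, hdata⟩))).2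

lemma Halpha_eq_Halpha_iff (hΛ : 0 < Λ) :
    Halpha Λ αL αR = Halpha Λ βL βR ↔ αL = βL ∧ αR = βR := by
  refine ⟨fun h => ?_, fun ⟨hL, hR⟩ => by rw [hL, hR]⟩
  obtain ⟨hleL, hleR⟩ := robinLine_le_of_Halpha_le hΛ h.le
  obtain ⟨hgeL, hgeR⟩ := robinLine_le_of_Halpha_le hΛ h.ge
  exact ⟨robinLine_injective (hleL.antisymm hgeL), robinLine_injective (hleR.antisymm hgeR)⟩

end GammaOperators

/-! ### Decomposition into the two islands -/

section Restriction

variable {X E : Type*} [MeasurableSpace X] [NormedAddCommGroup E] [InnerProductSpace ℂ E]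
  {μ ν : Measure X} {A B : Set X}

/-- The restriction of functions to a smaller measure, as a linear map between the spaces of square
integrable functions. -/
def restrictL2 (h : ν ≤ μ) : Lp E 2 μ →ₗ[ℂ] Lp E 2 ν where
  toFun f := ((Lp.memLp f).mono_measure h).toLp f
  map_add' f g := by
    rw [← MemLp.toLp_add]
    exact MemLp.toLp_congr _ _ ((Measure.absolutelyContinuous_of_le h).ae_le (Lp.coeFn_add f g))
  map_smul' c f := by
    rw [RingHom.id_apply, ← MemLp.toLp_const_smul]
    exact MemLp.toLp_congr _ _ ((Measure.absolutelyContinuous_of_le h).ae_le (Lp.coeFn_smul c f))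

lemma restrictL2_ae_eq (h : ν ≤ μ) (f : Lp E 2 μ) : restrictL2 h f =ᵐ[ν] f :=
  ((Lp.memLp f).mono_measure h).coeFn_toLp

lemma inner_restrictL2 (h : ν ≤ μ) (f g : Lp E 2 μ) :
    inner ℂ (restrictL2 h f) (restrictL2 h g) = ∫ x, inner ℂ (f x) (g x) ∂ν := by
  rw [L2.inner_def]
  refine integral_congr_ae ?_
  filter_upwards [restrictL2_ae_eq h f, restrictL2_ae_eq h g] with x hf hg
  rw [hf, hg]

/-- The map `f ↦ (f|A, f|B)` on the square integrable functions on `A ∪ B`. -/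
def splitUnion (μ : Measure X) (A B : Set X) : Lp E 2 (μ.restrict (A ∪ B)) →ₗ[ℂ]
    WithLp 2 (Lp E 2 (μ.restrict A) × Lp E 2 (μ.restrict B)) :=
  (WithLp.linearEquiv 2 ℂ _).symm.toLinearMap ∘ₗ
    (restrictL2 (Measure.restrict_mono_set μ subset_union_left)).prod
      (restrictL2 (Measure.restrict_mono_set μ subset_union_right))

lemma splitUnion_fst_ae_eq (f : Lp E 2 (μ.restrict (A ∪ B))) :
    (splitUnion μ A B f).fst =ᵐ[μ.restrict A] f :=
  restrictL2_ae_eq _ f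

lemma splitUnion_snd_ae_eq (f : Lp E 2 (μ.restrict (A ∪ B))) :
    (splitUnion μ A B f).snd =ᵐ[μ.restrict B] f :=
  restrictL2_ae_eq _ f

lemma inner_splitUnion (hAB : Disjoint A B) (hB : MeasurableSet B)
    (f g : Lp E 2 (μ.restrict (A ∪ B))) :
    inner ℂ (splitUnion μ A B f) (splitUnion μ A B g) = inner ℂ f g := by
  have hfg : IntegrableOn (fun x => inner ℂ (f x) (g x)) (A ∪ B) μ := L2.integrable_inner f g
  rw [L2.inner_def f g, setIntegral_union hAB hB hfg.left_of_union hfg.right_of_union,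
    WithLp.prod_inner_apply]
  exact congrArg₂ _ (inner_restrictL2 _ f g) (inner_restrictL2 _ f g)

lemma splitUnion_surjective (hAB : Disjoint A B) (hA : MeasurableSet A) (hB : MeasurableSet B) :
    Function.Surjective (splitUnion (E := E) μ A B) := by
  classical
  intro p
  have hglue : MemLp (A.piecewise p.fst p.snd) 2 (μ.restrict (A ∪ B)) := by
    refine MemLp.piecewise hA ?_ ?_
    · rw [Measure.restrict_restrict hA, inter_eq_left.2 subset_union_left]
      exact Lp.memLp _
    · rw [Measure.restrict_restrict hA.compl, inter_comm, ← sdiff_eq, union_sdiff_left,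
        hAB.symm.sdiff_eq_left]
      exact Lp.memLp _
  obtain ⟨hA_eq, hB_eq⟩ := (ae_restrict_union_iff _ _ _).1 hglue.coeFn_toLp
  refine ⟨hglue.toLp _, WithLp.ofLp_injective 2 (Prod.ext (Lp.ext ?_) (Lp.ext ?_))⟩
  · filter_upwards [splitUnion_fst_ae_eq (hglue.toLp _), hA_eq, ae_restrict_mem hA]
      with x hsplit htoLp hx
    exact hsplit.trans (htoLp.trans (piecewise_eq_of_mem _ _ _ hx))
  · filter_upwards [splitUnion_snd_ae_eq (hglue.toLp _), hB_eq, ae_restrict_mem hB]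
      with x hsplit htoLp hx
    exact hsplit.trans (htoLp.trans (piecewise_eq_of_notMem _ _ _ (disjoint_right.1 hAB hx)))

/-- The unitary map `f ↦ (f|A, f|B)` on the square integrable functions on a disjoint union. -/
def splitUnionEquiv (hAB : Disjoint A B) (hA : MeasurableSet A) (hB : MeasurableSet B) :
    Lp E 2 (μ.restrict (A ∪ B)) ≃ₗᵢ[ℂ] WithLp 2 (Lp E 2 (μ.restrict A) × Lp E 2 (μ.restrict B)) :=
  .ofSurjective (LinearMap.isometryOfInner (splitUnion μ A B) (inner_splitUnion hAB hB))
    (splitUnion_surjective hAB hA hB)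

end Restriction

lemma mem_graph_directSum_iff {E F : Type*} [NormedAddCommGroup E] [InnerProductSpace ℂ E]
    [NormedAddCommGroup F] [InnerProductSpace ℂ F] {A : E →ₗ.[ℂ] E} {B : F →ₗ.[ℂ] F}
    {p q : WithLp 2 (E × F)} : (p, q) ∈ (directSum A B).graph ↔
      (p.fst, q.fst) ∈ A.graph ∧ (p.snd, q.snd) ∈ B.graph := by
  simp only [LinearPMap.mem_graph_iff]
  constructor
  · rintro ⟨y, rfl, rfl⟩
    exact ⟨⟨⟨_, y.2.1⟩, rfl, rfl⟩, ⟨_, y.2.2⟩, rfl, rfl⟩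
  · rintro ⟨⟨a, hpa, hqa⟩, b, hpb, hqb⟩
    have hp : p ∈ (directSum A B).domain := ⟨hpa ▸ a.2, hpb ▸ b.2⟩
    refine ⟨⟨p, hp⟩, rfl, WithLp.ofLp_injective 2 (Prod.ext ?_ ?_)⟩
    · exact (congrArg A (Subtype.ext hpa.symm)).trans hqa
    · exact (congrArg B (Subtype.ext hpb.symm)).trans hqb

section Splitting

variable {Λ : ℝ}

lemma mem_graph_HalphaLeft_iff {α : OnePoint ℝ} {f g : L2 (leftIsland Λ)} :
    (f, g) ∈ (HalphaLeft Λ α).graph ↔ ∃ u p, IsH2On (Iio (-Λ)) u p (-⇑g) ∧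
      f =ᵐ[volume.restrict (Iio (-Λ))] u ∧ (u (-Λ), p (-Λ)) ∈ robinLine α := by
  rw [HalphaLeft, mem_graph_boundaryOperator_iff (isRegular_Iio _)]
  · simp only [mem_singleton_iff, forall_eq]
    rfl
  · rintro b rfl
    exact (closure_Iio (-Λ)).ge self_mem_Iic

lemma mem_graph_HalphaRight_iff {α : OnePoint ℝ} {f g : L2 (rightIsland Λ)} :
    (f, g) ∈ (HalphaRight Λ α).graph ↔ ∃ u p, IsH2On (Ioi Λ) u p (-⇑g) ∧
      f =ᵐ[volume.restrict (Ioi Λ)] u ∧ (u Λ, p Λ) ∈ robinLine α := by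
  rw [HalphaRight, mem_graph_boundaryOperator_iff (isRegular_Ioi _)]
  · simp only [mem_singleton_iff, forall_eq]
    rfl
  · rintro b rfl
    exact (closure_Ioi Λ).ge self_mem_Ici

/-- The unitary map `ψ ↦ (ψ|Ω_L, ψ|Ω_R)`. -/
def split (hΛ : 0 < Λ) :
    L2 (islands Λ) ≃ₗᵢ[ℂ] WithLp 2 (L2 (leftIsland Λ) × L2 (rightIsland Λ)) :=
  splitUnionEquiv (((disjoint_Iic_neg_Ici hΛ).mono_left Iio_subset_Iic_self).mono_right
    Ioi_subset_Ici_self) measurableSet_Iio measurableSet_Ioi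

lemma split_fst_ae_eq (hΛ : 0 < Λ) (f : L2 (islands Λ)) :
    (split hΛ f).fst =ᵐ[volume.restrict (Iio (-Λ))] f :=
  splitUnion_fst_ae_eq f

lemma split_snd_ae_eq (hΛ : 0 < Λ) (f : L2 (islands Λ)) :
    (split hΛ f).snd =ᵐ[volume.restrict (Ioi Λ)] f :=
  splitUnion_snd_ae_eq f

lemma split_intertwines (hΛ : 0 < Λ) (αL αR : OnePoint ℝ) :
    Intertwines (split hΛ) (Halpha Λ αL αR)
      (directSum (HalphaLeft Λ αL) (HalphaRight Λ αR)) := by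
  intro f g
  rw [mem_graph_directSum_iff, mem_graph_Halpha_iff hΛ, mem_graph_HalphaLeft_iff,
    mem_graph_HalphaRight_iff]
  have left_eq := isRegular_Iio (-Λ) |>.ae_eq_closure
  have right_eq := isRegular_Ioi Λ |>.ae_eq_closure
  constructor
  · rintro ⟨_, hl, _, hr, u, p, hu, hf, rfl, rfl⟩
    obtain ⟨hf_left, hf_right⟩ := (ae_restrict_union_iff _ _ _).1 hf
    exact ⟨⟨u, p,
        (hu.mono subset_union_left).congr_deriv_deriv left_eq (split_fst_ae_eq hΛ g).neg,
        (split_fst_ae_eq hΛ f).trans hf_left, hl⟩,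
      u, p, (hu.mono subset_union_right).congr_deriv_deriv right_eq (split_snd_ae_eq hΛ g).neg,
        (split_snd_ae_eq hΛ f).trans hf_right, hr⟩
  · rintro ⟨⟨u, p, hu, hfu, hl⟩, v, q, hv, hfv, hr⟩
    exact ⟨_, hl, _, hr, .of_sides hΛ
      (hu.congr_deriv_deriv left_eq (split_fst_ae_eq hΛ g).symm.neg)
      (hv.congr_deriv_deriv right_eq (split_snd_ae_eq hΛ g).symm.neg)
      ((split_fst_ae_eq hΛ f).symm.trans hfu) ((split_snd_ae_eq hΛ f).symm.trans hfv)⟩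

end Splitting

end Junction

end

theorem mainTheorem1 (Λ : ℝ) (hΛ : 0 < Λ) :
    -- the adjoint of `H₀` is `-d²/dx²` on `AC²`
    (Junction.H0 Λ)† = Junction.maxOperator (Junction.islands Λ) ∧
    -- (i)
    (∀ θL ∈ Ico 0 (2 * Real.pi), ∀ θR ∈ Ico 0 (2 * Real.pi),
      (Junction.Hgamma Λ (Junction.phase Λ θL) (Junction.phase Λ θR)).domain =
        Junction.gammaDomain Λ (Junction.phase Λ θL) (Junction.phase Λ θR) ∧
      Junction.IsSelfAdjointExtension (Junction.H0 Λ)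
        (Junction.Hgamma Λ (Junction.phase Λ θL) (Junction.phase Λ θR))) ∧
    -- (ii)
    (∀ αL αR : OnePoint ℝ,
      Junction.IsSelfAdjointExtension (Junction.H0 Λ) (Junction.Halpha Λ αL αR)) ∧
    -- (iii), the correspondence
    (∀ θL ∈ Ico 0 (2 * Real.pi), ∀ θR ∈ Ico 0 (2 * Real.pi), ∀ αL αR : OnePoint ℝ,
      Junction.Halpha Λ αL αR =
          Junction.Hgamma Λ (Junction.phase Λ θL) (Junction.phase Λ θR) ↔
        αL = Junction.alphaLeft θL ∧ αR = Junction.alphaRight θR) ∧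
    BijOn (fun θ : ℝ × ℝ => (Junction.alphaLeft θ.1, Junction.alphaRight θ.2))
      (Ico 0 (2 * Real.pi) ×ˢ Ico 0 (2 * Real.pi)) univ ∧
    -- (iii), the decomposition, through the unitary map `ψ ↦ (ψ|Ω_L, ψ|Ω_R)`
    ∃ U : Junction.L2 (Junction.islands Λ) ≃ₗᵢ[ℂ]
        WithLp 2 (Junction.L2 (Junction.leftIsland Λ) × Junction.L2 (Junction.rightIsland Λ)),
      (∀ f, (U f).fst =ᵐ[volume.restrict (Junction.leftIsland Λ : Set ℝ)] f ∧
        (U f).snd =ᵐ[volume.restrict (Junction.rightIsland Λ : Set ℝ)] f) ∧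
      ∀ αL αR : OnePoint ℝ, Junction.Intertwines U (Junction.Halpha Λ αL αR)
        (Junction.directSum (Junction.HalphaLeft Λ αL) (Junction.HalphaRight Λ αR)) := by
  refine ⟨Junction.adjoint_H0 hΛ, fun θL hL θR hR => ?_, fun αL αR => ?_,
    fun θL hL θR hR αL αR => ?_, ?_, Junction.split hΛ, fun f => ?_, Junction.split_intertwines hΛ⟩
  · rw [Junction.Hgamma_eq_Halpha hΛ hL hR, Junction.gammaDomain_eq_domain_Halpha hΛ hL hR]
    exact ⟨rfl, Junction.H0_le_Halpha hΛ _ _, Junction.isSelfAdjoint_Halpha hΛ _ _⟩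
  · exact ⟨Junction.H0_le_Halpha hΛ _ _, Junction.isSelfAdjoint_Halpha hΛ _ _⟩
  · rw [Junction.Hgamma_eq_Halpha hΛ hL hR, Junction.Halpha_eq_Halpha_iff hΛ]
  · rw [← univ_prod_univ]
    exact Junction.bijOn_alphaLeft.prodMap Junction.bijOn_alphaRight
  · exact ⟨Junction.split_fst_ae_eq hΛ f, Junction.split_snd_ae_eq hΛ f⟩
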